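/- Let $K$ be a field, let $L$ be a finite distributive lattice, identified with the lattice of order ideals of a finite poset $P$, and let $A$ be the incidence algebra of $L$ over $K$, with $K$-basis $p^x_y$ ($x\le y$ in $L$) and product $p^x_y\,p^{y'}_z=\delta_{y,y'}\,p^x_z$. Modules are right $A$-modules; for $x\in L$ let $S_x$ be the simple right $A$-module corresponding to $x$ (it is one-dimensional, $p^x_x$ acts as the identity and all other $p^y_z$ act as $0$). Let $\operatorname{cov}(x)$ be the set of elements of $L$ that cover $x$, and let rowmotion $\operatorname{row}:L\to L$ send an order ideal $x$ of $P$ to the order ideal of $P$ generated by the minimal elements of $P\setminus x$. Write $D=\operatorname{Hom}_K(-,K)$, $\operatorname{top}M=M/\operatorname{rad}M$, $\operatorname{grade}M=\inf\{\ell\ge 0\mid \operatorname{Ext}^\ell_A(M,A)\ne0\}$, and $\tau_r=D\operatorname{Tr}\Omega^{r-1}$ for $r\ge1$, where $\Omega^{i}$ denotes the $i$-th syzygy (taken with projective covers) and $\operatorname{Tr}$ the Auslander–Bridger transpose (taken with minimal projective presentations). Then for every $x\in L$: 1. $\operatorname{grade}S_x=\operatorname{pdim}S_x=|\operatorname{cov}(x)|$.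 2. The grade bijection $g_A$, given on simple modules by $g_A(S)=\operatorname{top}(D\operatorname{Ext}_A^g(S,A))$ with $g=\operatorname{grade}S$, satisfies $g_A(S_x)\cong S_{\operatorname{row}(x)}$ as right $A$-modules. 3. If $x$ is not the maximum of $L$, then with $p=|\operatorname{cov}(x)|\ge1$ one has $\operatorname{top}(\tau_p(S_x))\cong S_{\operatorname{row}(x)}$ as right $A$-modules. -/

import Mathlib

open CategoryTheory

universe u v

/-! Right modules over a ring `A` are modules over `Aᵐᵒᵖ`; left modules are modules over `A`. -/

/-! ### Duality and top -/

section Dual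

variable (K A N : Type*) [Field K] [Ring A] [Algebra K A] [AddCommGroup N] [Module A N]

/-- The `K`-dual `D N = Hom_K(N, K)` of a left `A`-module `N`, where `K` acts on `N`
through `K → A`. -/
def KDual : Type _ := RestrictScalars K A N →ₗ[K] K

instance : AddCommGroup (KDual K A N) :=
  inferInstanceAs (AddCommGroup (RestrictScalars K A N →ₗ[K] K))

/-- The right `A`-module structure on `Hom_K(N, K)`: `(φ · a)(n) = φ (a n)`. -/
noncomputable abbrev kDualModule : Module Aᵐᵒᵖ (RestrictScalars K A N →ₗ[K] K) where
  smul a φ := φ ∘ₗ RestrictScalars.lsmul K A N a.unop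
  one_smul φ := by
    change φ ∘ₗ RestrictScalars.lsmul K A N 1 = φ
    rw [map_one]; rfl
  mul_smul a b φ := by
    change φ ∘ₗ RestrictScalars.lsmul K A N (b.unop * a.unop) = _
    rw [map_mul]; rfl
  smul_zero a := LinearMap.zero_comp _
  smul_add a φ ψ := LinearMap.add_comp _ _ _
  add_smul a b φ := by
    change φ ∘ₗ RestrictScalars.lsmul K A N (a.unop + b.unop) = _
    rw [map_add]; exact LinearMap.comp_add _ _ _
  zero_smul φ := by
    change φ ∘ₗ RestrictScalars.lsmul K A N 0 = _
    rw [map_zero]; exact LinearMap.comp_zero _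

noncomputable instance : Module Aᵐᵒᵖ (KDual K A N) := kDualModule K A N

end Dual

/-- The top `M / rad M` of a module, `rad M` being the intersection of the maximal submodules. -/
abbrev ModuleTop (R M : Type*) [Ring R] [AddCommGroup M] [Module R M] : Type _ :=
  M ⧸ Module.jacobson R M

/-! ### Ext into the regular module, grade and grade map -/

section Grade

variable (A : Type u) [Ring A]

/-- `A` as a right module over itself. -/
abbrev regularModule : ModuleCat.{u} Aᵐᵒᵖ := ModuleCat.of Aᵐᵒᵖ A

/-- Left multiplication by `a`, as an endomorphism of the right module `A`. -/
def leftMul (a : A) : regularModule A ⟶ regularModule A :=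
  ModuleCat.ofHom
    { toFun := fun b => a * b
      map_add' := mul_add a
      map_smul' := fun c b => (mul_assoc a b c.unop).symm }

variable {A}

/-- `Ext_A^n(M, A)` for a right `A`-module `M`. -/
def ExtReg (M : ModuleCat.{u} Aᵐᵒᵖ) (n : ℕ) : Type u :=
  Abelian.Ext.{u} M (regularModule A) n

noncomputable instance (M : ModuleCat.{u} Aᵐᵒᵖ) (n : ℕ) : AddCommGroup (ExtReg M n) :=
  inferInstanceAs (AddCommGroup (Abelian.Ext.{u} M (regularModule A) n))

/-- The left `A`-module structure on `Ext_A^n(M, A)`, induced by functoriality in the second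
argument from left multiplications. -/
noncomputable abbrev extRegModule (M : ModuleCat.{u} Aᵐᵒᵖ) (n : ℕ) :
    Module A (Abelian.Ext.{u} M (regularModule A) n) where
  smul a ξ := ξ.comp (Abelian.Ext.mk₀ (leftMul A a)) (add_zero n)
  one_smul ξ := by
    have h : leftMul A 1 = 𝟙 _ :=
      ModuleCat.hom_ext (LinearMap.ext fun x : A => one_mul x)
    change ξ.comp (Abelian.Ext.mk₀ (leftMul A 1)) (add_zero n) = ξ
    rw [h, Abelian.Ext.comp_mk₀_id]
  mul_smul a b ξ := by
    have h : leftMul A (a * b) = leftMul A b ≫ leftMul A a :=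
      ModuleCat.hom_ext (LinearMap.ext fun x : A => mul_assoc a b x)
    change ξ.comp (Abelian.Ext.mk₀ (leftMul A (a * b))) (add_zero n) =
      (ξ.comp (Abelian.Ext.mk₀ (leftMul A b)) (add_zero n)).comp
        (Abelian.Ext.mk₀ (leftMul A a)) (add_zero n)
    rw [h, ← Abelian.Ext.mk₀_comp_mk₀, Abelian.Ext.comp_assoc_of_third_deg_zero]
  smul_zero a := by
    change (0 : Abelian.Ext.{u} M (regularModule A) n).comp
      (Abelian.Ext.mk₀ (leftMul A a)) (add_zero n) = 0
    exact Abelian.Ext.zero_comp (X := M) (Y := regularModule A) _ _ _ _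
  smul_add a ξ η := Abelian.Ext.add_comp _ _ _ _
  add_smul a b ξ := by
    have h : leftMul A (a + b) = leftMul A a + leftMul A b :=
      ModuleCat.hom_ext (LinearMap.ext fun x : A => add_mul a b x)
    change ξ.comp (Abelian.Ext.mk₀ (leftMul A (a + b))) (add_zero n) = _
    rw [h, Abelian.Ext.mk₀_add]; exact Abelian.Ext.comp_add _ _ _ _
  zero_smul ξ := by
    have h : leftMul A (0 : A) = 0 :=
      ModuleCat.hom_ext (LinearMap.ext fun x : A => zero_mul x)
    change ξ.comp (Abelian.Ext.mk₀ (leftMul A 0)) (add_zero n) = 0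
    rw [h, Abelian.Ext.mk₀_zero]; exact Abelian.Ext.comp_zero _ _ _ _ _

noncomputable instance (M : ModuleCat.{u} Aᵐᵒᵖ) (n : ℕ) : Module A (ExtReg M n) :=
  extRegModule M n

/-- The grade `inf {n | Ext_A^n(M, A) ≠ 0}` of a right module (`⊤` if there is no such `n`). -/
noncomputable def moduleGrade (M : ModuleCat.{u} Aᵐᵒᵖ) : ℕ∞ :=
  ⨅ (n : ℕ) (_ : Nontrivial (ExtReg M n)), (n : ℕ∞)

/-- `g_A(M) = top (D Ext_A^g(M, A))`, a right `A`-module, where `g` is the grade of `M`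
(meaningful when the grade is finite). -/
abbrev GradeMap (K : Type u) [Field K] [Algebra K A] (M : ModuleCat.{u} Aᵐᵒᵖ) : Type u :=
  ModuleTop Aᵐᵒᵖ (KDual K A (ExtReg M (moduleGrade M).toNat))

end Grade

/-! ### Syzygies, transpose and higher Auslander-Reiten translates -/

/-- A submodule `N` of `M` is superfluous if `U + N = M` implies `U = M`. -/
def IsSuperfluous {R M : Type*} [Ring R] [AddCommGroup M] [Module R M]
    (N : Submodule R M) : Prop :=
  ∀ U : Submodule R M, U ⊔ N = ⊤ → U = ⊤

/-- `f : P → M` is a projective cover of `M`. -/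
structure IsProjectiveCover {R P M : Type*} [Ring R] [AddCommGroup P] [Module R P]
    [AddCommGroup M] [Module R M] (f : P →ₗ[R] M) : Prop where
  projective : Module.Projective R P
  surjective : Function.Surjective f
  superfluous : IsSuperfluous (LinearMap.ker f)

/-- `N` is isomorphic to the `n`-th syzygy of `M`: `Ω⁰(M) = M`, and `Ωⁿ⁺¹(M)` is the kernel of
a projective cover of `Ωⁿ(M)`. -/
def IsSyzygy {R : Type u} [Ring R] : ℕ → ModuleCat.{u} R → ModuleCat.{u} R → Prop
  | 0, M, N => Nonempty (N ≃ₗ[R] M)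
  | n + 1, M, N => ∃ (X P : ModuleCat.{u} R) (f : P →ₗ[R] X),
      IsSyzygy n M X ∧ IsProjectiveCover f ∧ Nonempty (N ≃ₗ[R] LinearMap.ker f)

/-- `P₁ --f--> P₀ --π--> M → 0` is a minimal projective presentation: `π` is a projective cover
of `M`, and `f` is a projective cover of `ker π` followed by the inclusion. -/
structure IsMinimalPresentation {R P₁ P₀ M : Type*} [Ring R] [AddCommGroup P₁] [Module R P₁]
    [AddCommGroup P₀] [Module R P₀] [AddCommGroup M] [Module R M]
    (f : P₁ →ₗ[R] P₀) (π : P₀ →ₗ[R] M) : Prop where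
  cover : IsProjectiveCover π
  exact : LinearMap.range f = LinearMap.ker π
  projective : Module.Projective R P₁
  superfluous : IsSuperfluous (LinearMap.ker f)

/-- The left module `T` is isomorphic to the Auslander-Bridger transpose of the right module `M`:
the cokernel of `Hom_A(f, A) : Hom_A(P₀, A) → Hom_A(P₁, A)` for a minimal projective
presentation `P₁ --f--> P₀ → M → 0`. -/
def IsTranspose {A : Type u} [Ring A] (M : ModuleCat.{u} Aᵐᵒᵖ) (T : ModuleCat.{u} A) : Prop :=
  ∃ (P₁ P₀ : ModuleCat.{u} Aᵐᵒᵖ) (f : P₁ →ₗ[Aᵐᵒᵖ] P₀) (π : P₀ →ₗ[Aᵐᵒᵖ] M),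
    IsMinimalPresentation f π ∧
      Nonempty (T ≃ₗ[A] (P₁ →ₗ[Aᵐᵒᵖ] A) ⧸ LinearMap.range (LinearMap.lcomp A A f))

/-- `N` is isomorphic to the `r`-Auslander-Reiten translate `τ_r(M) = D Tr Ω^{r-1}(M)`, for
`r ≥ 1`. -/
def IsARTranslate (K : Type u) {A : Type u} [Field K] [Ring A] [Algebra K A] (r : ℕ)
    (M N : ModuleCat.{u} Aᵐᵒᵖ) : Prop :=
  1 ≤ r ∧ ∃ (X : ModuleCat.{u} Aᵐᵒᵖ) (T : ModuleCat.{u} A),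
    IsSyzygy (r - 1) M X ∧ IsTranspose X T ∧ Nonempty (N ≃ₗ[Aᵐᵒᵖ] KDual K A T)

/-! ### Simple modules over incidence algebras, and rowmotion -/

section Incidence

variable (K : Type u) {L : Type u} [Field K] [PartialOrder L]

/-- The underlying one-dimensional space of the simple module at `x`. -/
def SimpleAt (_x : L) : Type u := K

instance (x : L) : AddCommGroup (SimpleAt K x) := inferInstanceAs (AddCommGroup K)

variable [LocallyFiniteOrder L] [DecidableEq L]

/-- An element `f` of the incidence algebra acts on the right on the simple module at `x` by
multiplication with `f x x`. -/
abbrev simpleAtModule (x : L) : Module (IncidenceAlgebra K L)ᵐᵒᵖ K where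
  smul f k := k * f.unop x x
  one_smul k := by
    change k * (1 : IncidenceAlgebra K L) x x = k
    simp
  mul_smul f g k := by
    change k * (g.unop * f.unop) x x = k * g.unop x x * f.unop x x
    simp [IncidenceAlgebra.mul_apply, mul_assoc]
  smul_zero f := zero_mul _
  smul_add f k l := add_mul k l _
  add_smul f g k := mul_add k _ _
  zero_smul k := mul_zero k

instance (x : L) : Module (IncidenceAlgebra K L)ᵐᵒᵖ (SimpleAt K x) := simpleAtModule K x

/-- The simple right module `S_x` over the incidence algebra corresponding to `x`. -/
abbrev simpleModule (x : L) : ModuleCat.{u} (IncidenceAlgebra K L)ᵐᵒᵖ :=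
  ModuleCat.of (IncidenceAlgebra K L)ᵐᵒᵖ (SimpleAt K x)

end Incidence

/-- Rowmotion on order ideals: `I` is sent to the order ideal generated by the minimal elements
of the complement of `I`. -/
def rowmotion {P : Type*} [PartialOrder P] (I : LowerSet P) : LowerSet P :=
  lowerClosure {p | Minimal (fun q => q ∉ I) p}

/-- The set of elements covering `x`. -/
def covers {L : Type*} [PartialOrder L] (x : L) : Set L := {y | x ⋖ y}

/-! For `x` in `L` let `Q_x` be the projective right module of functions supported above `x`, and
let `m₁, …, m_p` be the minimal elements of the complement of the order ideal `x`. The covers of `x`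
are the joins `x ⊔ tᵢ`, where `tᵢ` is the principal ideal of `mᵢ`, so `S_x` is the quotient of `Q_x`
by the submodules `Q_{x ⊔ tᵢ}`. Dividing these out one at a time gives short exact sequences `0 →
M(T, x ⊔ t) → M(T, x) → M(t :: T, x) → 0`, the inductive form of a Koszul-type resolution of length
`p`.

Along these sequences `Ext^{|T|}(M(T, x), A)` stays cyclic (`exists_smul_koszulClass`), and `a`
kills its generator iff the column of `a` at the join of `x` and `T` vanishes on an explicit
essential set (`smul_koszulClass_eq_zero_iff`). The lower Ext groups vanish as long as the essential
sets grow with `x` (`subsingleton_extReg_koszulModule`). Distributivity enters only in the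
combinatorics: for `S_x` the essential set consists of the ideals that contain every `mᵢ` and lie in
`c = x ∪ {m₁, …, m_p}`, which is the interval `[row x, c]`. So `Ext^p(S_x, A)` is the only nonzero
Ext group, whence grade and projective dimension are both `p`. It has a basis indexed by this
interval, with the basis vector at `row x` spanning the socle, and its dual has simple top at `row
x` (`nonempty_top_kDual_equiv`).

For the translate, `Ω^{p-1} S_x` has projective dimension at most one, so its minimal presentation
is a resolution and its transpose is its `Ext¹` into `A`, that is, `Ext^p(S_x, A)`. Thus `τ_p S_x =
D Ext^p(S_x, A)`, and the third claim reduces to the second. -/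

set_option linter.unusedSectionVars false

/-! ### Functoriality of `Ext(-, A)` as a left `A`-module -/

section ExtFunctoriality

variable {A : Type u} [Ring A]

namespace ExtReg

/-- Pullback of extension classes along a morphism, as a map of left `A`-modules. -/
noncomputable def pullback {M N : ModuleCat.{u} Aᵐᵒᵖ} (f : M ⟶ N) (n : ℕ) :
    ExtReg N n →ₗ[A] ExtReg M n where
  toFun ξ := (Abelian.Ext.mk₀ f).comp ξ (zero_add n)
  map_add' _ _ := Abelian.Ext.comp_add _ _ _ _
  map_smul' _ _ := (Abelian.Ext.comp_assoc_of_third_deg_zero _ _ _ _).symm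

/-- The connecting map of `Ext(-, A)`, as a map of left `A`-modules. -/
noncomputable def connecting {S : ShortComplex (ModuleCat.{u} Aᵐᵒᵖ)} (hS : S.ShortExact) (n : ℕ) :
    ExtReg S.X₁ n →ₗ[A] ExtReg S.X₃ (n + 1) where
  toFun ξ := hS.extClass.comp ξ (add_comm 1 n)
  map_add' _ _ := Abelian.Ext.comp_add _ _ _ _
  map_smul' _ _ := (Abelian.Ext.comp_assoc_of_third_deg_zero _ _ _ _).symm

variable {S : ShortComplex (ModuleCat.{u} Aᵐᵒᵖ)} (hS : S.ShortExact)

lemma pullback_id {M : ModuleCat.{u} Aᵐᵒᵖ} (n : ℕ) :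
    pullback (𝟙 M) n = LinearMap.id :=
  LinearMap.ext fun ξ => Abelian.Ext.mk₀_id_comp (X := M) (Y := regularModule A) ξ

lemma pullback_comp {M N Q : ModuleCat.{u} Aᵐᵒᵖ} (f : M ⟶ N) (g : N ⟶ Q) (n : ℕ) :
    pullback (f ≫ g) n = pullback f n ∘ₗ pullback g n :=
  LinearMap.ext fun ξ =>
    (Abelian.Ext.mk₀_comp_mk₀_assoc f g (T := regularModule A) ξ).symm

/-- Isomorphic modules have isomorphic `Ext(-, A)`. -/
noncomputable def congr {M N : ModuleCat.{u} Aᵐᵒᵖ} (e : M ≅ N) (n : ℕ) :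
    ExtReg N n ≃ₗ[A] ExtReg M n :=
  LinearEquiv.ofLinearMap (pullback e.hom n) (pullback e.inv n)
    (by rw [← pullback_comp, e.hom_inv_id, pullback_id])
    (by rw [← pullback_comp, e.inv_hom_id, pullback_id])

include hS in
lemma exact_pullback_pullback (n : ℕ) : Function.Exact (pullback S.g n) (pullback S.f n) := by
  intro ξ
  constructor
  · intro h
    exact Abelian.Ext.contravariant_sequence_exact₂ hS (Y := regularModule A) ξ h
  · rintro ⟨η, rfl⟩
    have := LinearMap.congr_fun (pullback_comp S.f S.g n) η
    rw [S.zero] at this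
    rw [← LinearMap.comp_apply, ← this]
    exact (congrArg (fun z => z.comp (Z := regularModule A) η (zero_add n))
      (Abelian.Ext.mk₀_zero S.X₁ S.X₃)).trans (Abelian.Ext.zero_comp _ _ _ _ _)

lemma exact_pullback_connecting (n : ℕ) :
    Function.Exact (pullback S.f n) (connecting hS n) := by
  intro ξ
  constructor
  · intro h
    exact Abelian.Ext.contravariant_sequence_exact₁ hS (Y := regularModule A) ξ (add_comm 1 n) h
  · rintro ⟨η, rfl⟩
    exact hS.extClass_comp_assoc (Y := regularModule A) η (h := add_comm 1 n)

lemma exact_connecting_pullback (n : ℕ) :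
    Function.Exact (connecting hS n) (pullback S.g (n + 1)) := by
  intro ξ
  constructor
  · intro h
    exact Abelian.Ext.contravariant_sequence_exact₃ hS (Y := regularModule A) ξ h (add_comm 1 n)
  · rintro ⟨η, rfl⟩
    exact hS.comp_extClass_assoc (Y := regularModule A) η (add_comm 1 n)

lemma connecting_surjective (n : ℕ) [Subsingleton (ExtReg S.X₂ (n + 1))] :
    Function.Surjective (connecting hS n) := fun ξ =>
  (exact_connecting_pullback hS n ξ).1 (Subsingleton.elim _ _)

lemma connecting_injective (n : ℕ) [Subsingleton (ExtReg S.X₂ n)] :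
    Function.Injective (connecting hS n) := by
  rw [injective_iff_map_eq_zero]
  intro ξ h
  obtain ⟨η, rfl⟩ := (exact_pullback_connecting hS n ξ).1 h
  rw [Subsingleton.elim η 0, map_zero]

/-- This carries the comparison of generators of Ext through the induction on the list of joins. -/
lemma connecting_naturality {S' : ShortComplex (ModuleCat.{u} Aᵐᵒᵖ)} (hS' : S'.ShortExact)
    (f : S ⟶ S') (n : ℕ) (ξ : ExtReg S'.X₁ n) :
    pullback f.τ₃ (n + 1) (connecting hS' n ξ) = connecting hS n (pullback f.τ₁ n ξ) := by
  have h := ShortComplex.ShortExact.extClass_naturality hS hS' f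
  exact ((Abelian.Ext.comp_assoc (T := regularModule A) (Abelian.Ext.mk₀ f.τ₃) hS'.extClass ξ
    (zero_add 1) (add_comm 1 n) (a := n + 1) (by lia)).symm.trans
    (congrArg (fun z => z.comp (Z := regularModule A) ξ (add_comm 1 n)) h.symm)).trans
    (Abelian.Ext.comp_assoc_of_second_deg_zero _ _ _ _)

lemma subsingleton_of_hasProjectiveDimensionLT (M : ModuleCat.{u} Aᵐᵒᵖ) {d : ℕ}
    [HasProjectiveDimensionLT M d] {n : ℕ} (h : d ≤ n) : Subsingleton (ExtReg M n) :=
  HasProjectiveDimensionLT.subsingleton M d n h (regularModule A)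

/-- Dimension shifting. -/
noncomputable def shift (hP : Projective S.X₂) (n : ℕ) :
    ExtReg S.X₁ (n + 1) ≃ₗ[A] ExtReg S.X₃ (n + 2) :=
  haveI := subsingleton_of_hasProjectiveDimensionLT S.X₂ (d := 1) (n := n + 1) (by lia)
  haveI := subsingleton_of_hasProjectiveDimensionLT S.X₂ (d := 1) (n := n + 2) (by lia)
  LinearEquiv.ofBijective (connecting hS (n + 1))
    ⟨connecting_injective hS _, connecting_surjective hS _⟩

/-- A module homomorphism as a class in `Ext⁰`. -/
noncomputable def ofHom (M : ModuleCat.{u} Aᵐᵒᵖ) : (M →ₗ[Aᵐᵒᵖ] A) ≃ₗ[A] ExtReg M 0 where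
  toFun f := Abelian.Ext.mk₀ (Y := regularModule A) (ModuleCat.ofHom f)
  invFun ξ := (Abelian.Ext.addEquiv₀ (X := M) (Y := regularModule A) ξ).hom
  left_inv f := by
    have := Abelian.Ext.addEquiv₀.right_inv (ModuleCat.ofHom f : M ⟶ regularModule A)
    exact congrArg ModuleCat.Hom.hom this
  right_inv ξ := Abelian.Ext.mk₀_addEquiv₀_apply (X := M) (Y := regularModule A) ξ
  map_add' f g := Abelian.Ext.mk₀_add _ _
  map_smul' a f := (Abelian.Ext.mk₀_comp_mk₀
    (ModuleCat.ofHom f : M ⟶ regularModule A) (leftMul A a)).symm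

lemma pullback_ofHom {M N : ModuleCat.{u} Aᵐᵒᵖ} (f : M ⟶ N) (g : N →ₗ[Aᵐᵒᵖ] A) :
    pullback f 0 (ofHom N g) = ofHom M (g ∘ₗ f.hom) :=
  Abelian.Ext.mk₀_comp_mk₀ f (ModuleCat.ofHom g : N ⟶ regularModule A)

end ExtReg

end ExtFunctoriality

/-! ### Short exact sequences of modules -/

section ShortExact

variable {R : Type u} [Ring R]

/-- The short complex of modules attached to an exact pair of linear maps. -/
abbrev moduleShortComplex {M₁ M₂ M₃ : ModuleCat.{u} R} (f : M₁ →ₗ[R] M₂) (g : M₂ →ₗ[R] M₃)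
    (h : Function.Exact f g) : ShortComplex (ModuleCat.{u} R) :=
  ShortComplex.mk (ModuleCat.ofHom f) (ModuleCat.ofHom g)
    (ModuleCat.hom_ext (LinearMap.ext fun x => h.apply_apply_eq_zero x))

lemma moduleShortComplex_shortExact {M₁ M₂ M₃ : ModuleCat.{u} R} (f : M₁ →ₗ[R] M₂)
    (g : M₂ →ₗ[R] M₃) (h : Function.Exact f g) (hf : Function.Injective f)
    (hg : Function.Surjective g) : (moduleShortComplex f g h).ShortExact where
  exact := (ShortComplex.ShortExact.moduleCat_exact_iff_function_exact _).2 h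
  mono_f := (ModuleCat.mono_iff_injective _).2 hf
  epi_g := (ModuleCat.epi_iff_surjective _).2 hg

end ShortExact

/-! ### Functoriality of the dual and of the top -/

section Functoriality

/-- A linear map of modules over an algebra, as a linear map over the base field. -/
def restrictScalarsMap (K : Type*) {A N N' : Type*} [Field K] [Ring A] [Algebra K A]
    [AddCommGroup N] [Module A N] [AddCommGroup N'] [Module A N'] (f : N →ₗ[A] N') :
    RestrictScalars K A N →ₗ[K] RestrictScalars K A N' where
  toFun := f
  map_add' := f.map_add
  map_smul' c x := f.map_smul (algebraMap K A c) x

/-- Isomorphic left modules have isomorphic duals. -/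
noncomputable def KDual.congr {K A N N' : Type*} [Field K] [Ring A] [Algebra K A]
    [AddCommGroup N] [Module A N] [AddCommGroup N'] [Module A N'] (e : N ≃ₗ[A] N') :
    KDual K A N ≃ₗ[Aᵐᵒᵖ] KDual K A N' where
  toFun φ := LinearMap.comp (M₂ := RestrictScalars K A N) φ (restrictScalarsMap K e.symm.toLinearMap)
  invFun φ := LinearMap.comp (M₂ := RestrictScalars K A N') φ (restrictScalarsMap K e.toLinearMap)
  left_inv φ := LinearMap.ext fun x => congrArg (DFunLike.coe (F := RestrictScalars K A N →ₗ[K] K) φ) (e.symm_apply_apply x)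
  right_inv φ := LinearMap.ext fun x => congrArg (DFunLike.coe (F := RestrictScalars K A N' →ₗ[K] K) φ) (e.apply_symm_apply x)
  map_add' _ _ := rfl
  map_smul' a φ := LinearMap.ext fun x => congrArg (DFunLike.coe (F := RestrictScalars K A N →ₗ[K] K) φ) (e.symm.map_smul a.unop x).symm

/-- Isomorphic modules have isomorphic tops. -/
noncomputable def ModuleTop.congr {R M N : Type*} [Ring R] [AddCommGroup M] [Module R M]
    [AddCommGroup N] [Module R N] (e : M ≃ₗ[R] N) : ModuleTop R M ≃ₗ[R] ModuleTop R N :=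
  Submodule.Quotient.equiv _ _ e
    (Module.map_jacobson_of_ker_le (f := e.toLinearMap) e.surjective (by simp))

/-- If every element outside the kernel of a nonzero map onto a module without proper nonzero
submodules generates, then that module is the top. -/
lemma ModuleTop.nonempty_equiv {R M S : Type*} [Ring R] [AddCommGroup M] [Module R M]
    [AddCommGroup S] [Module R S] (π : M →ₗ[R] S) (hπ : Function.Surjective π) [Nontrivial S]
    (h : ∀ m, π m ≠ 0 → Submodule.span R {m} = ⊤) : Nonempty (ModuleTop R M ≃ₗ[R] S) := by
  have hle : ∀ N : Submodule R M, N ≠ ⊤ → N ≤ LinearMap.ker π := fun N hN m hm => by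
    by_contra hne
    exact hN (eq_top_iff.2 ((h m hne).ge.trans (by simpa using hm)))
  have hker : LinearMap.ker π ≠ ⊤ := fun hk => by
    obtain ⟨s, hs⟩ := exists_ne (0 : S)
    obtain ⟨m, rfl⟩ := hπ s
    exact hs (LinearMap.mem_ker.1 (hk ▸ Submodule.mem_top : m ∈ LinearMap.ker π))
  have hco : IsCoatom (LinearMap.ker π) :=
    ⟨hker, fun N hN => by_contra fun hne => hN.not_ge (hle N hne)⟩
  have hj : Module.jacobson R M = LinearMap.ker π :=
    le_antisymm (sInf_le hco) (le_sInf fun N hN =>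
      ((hN.le_iff.1 (hle N hN.1)).resolve_left hker).le)
  exact ⟨(Submodule.quotEquivOfEq _ _ hj).trans (π.quotKerEquivOfSurjective hπ)⟩

end Functoriality

/-! ### Syzygies and transposes in terms of Ext -/

section SyzygyTranspose

variable {A : Type u} [Ring A]

lemma projective_of_isProjectiveCover {R : Type u} [Ring R] {P X : ModuleCat.{u} R}
    {f : P →ₗ[R] X} (hf : IsProjectiveCover f) : Projective P := by
  have := hf.projective
  exact (IsProjective.iff_projective P).1 this

lemma shortExact_of_surjective {R : Type u} [Ring R] {P X : ModuleCat.{u} R} {f : P →ₗ[R] X}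
    (hf : Function.Surjective f) :
    (moduleShortComplex (M₁ := ModuleCat.of R (LinearMap.ker f)) (LinearMap.ker f).subtype f
      (LinearMap.exact_subtype_ker_map f)).ShortExact :=
  moduleShortComplex_shortExact _ _ _ (Submodule.subtype_injective _) hf

/-- A syzygy computes Ext in shifted degrees, and has correspondingly smaller projective
dimension. -/
lemma IsSyzygy.ext_shift {M : ModuleCat.{u} Aᵐᵒᵖ} :
    ∀ {n : ℕ} {X : ModuleCat.{u} Aᵐᵒᵖ}, IsSyzygy n M X →
      (∀ i, Nonempty (ExtReg X (i + 1) ≃ₗ[A] ExtReg M (i + 1 + n))) ∧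
      ∀ d, HasProjectiveDimensionLT M (d + 1 + n) → HasProjectiveDimensionLT X (d + 1)
  | 0, X, ⟨e⟩ => ⟨fun i => ⟨(ExtReg.congr e.toModuleIso (i + 1)).symm⟩,
      fun d h => hasProjectiveDimensionLT_of_iso e.toModuleIso.symm (d + 1)⟩
  | n + 1, N, ⟨X, P, f, hX, hf, ⟨e⟩⟩ => by
    obtain ⟨hExt, hpd⟩ := hX.ext_shift
    have hP := projective_of_isProjectiveCover hf
    have hS := shortExact_of_surjective hf.surjective
    have e' : N ≅ ModuleCat.of Aᵐᵒᵖ (LinearMap.ker f) := e.toModuleIso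
    refine ⟨fun i => ?_, fun d h => ?_⟩
    -- Ext of the projective cover vanishes in positive degrees only, so the shift is available for
    -- `i + 1` but not for degree zero.
    · obtain ⟨g⟩ := hExt (i + 1)
      rw [show i + 1 + (n + 1) = i + 1 + 1 + n by lia]
      exact ⟨((ExtReg.congr e' (i + 1)).symm.trans (ExtReg.shift hS hP i)).trans g⟩
    · rw [show d + 1 + (n + 1) = d + 1 + 1 + n by lia] at h
      have hX' := hpd (d + 1) h
      have := (hS.hasProjectiveDimensionLT_X₃_iff d hP).1 hX'
      exact hasProjectiveDimensionLT_of_iso e'.symm (d + 1)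

/-- A superfluous kernel of an epimorphism onto a projective module vanishes. -/
lemma injective_of_isSuperfluous {R P Q : Type*} [Ring R] [AddCommGroup P] [Module R P]
    [AddCommGroup Q] [Module R Q] [Module.Projective R Q] (f : P →ₗ[R] Q)
    (hf : Function.Surjective f) (h : IsSuperfluous (LinearMap.ker f)) :
    Function.Injective f := by
  obtain ⟨s, hs⟩ := Module.projective_lifting_property f LinearMap.id hf
  have hs' : ∀ q, f (s q) = q := LinearMap.congr_fun hs
  -- The range of the section and the kernel of `f` together span, so superfluity makes the section
  -- surjective and hence a two-sided inverse.
  have htop : LinearMap.range s = ⊤ := by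
    refine h _ (eq_top_iff.2 fun p _ => ?_)
    rw [← add_sub_cancel (s (f p)) p]
    refine Submodule.add_mem_sup ⟨f p, rfl⟩ ?_
    simp [hs']
  rw [LinearMap.range_eq_top] at htop
  exact (Function.LeftInverse.rightInverse_of_surjective (f := f) (g := s) hs' htop).injective

/-- The transpose of a module of projective dimension at most one is its first Ext module. -/
lemma IsTranspose.nonempty_equiv_ext {X : ModuleCat.{u} Aᵐᵒᵖ} {T : ModuleCat.{u} A}
    (h : IsTranspose X T) [hX : HasProjectiveDimensionLT X 2] : Nonempty (T ≃ₗ[A] ExtReg X 1) := by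
  obtain ⟨P₁, P₀, f, π, hmin, ⟨e⟩⟩ := h
  have hP₀ := projective_of_isProjectiveCover hmin.cover
  have hS := shortExact_of_surjective hmin.cover.surjective
  have hker := (hS.hasProjectiveDimensionLT_X₃_iff 0 hP₀).1 hX
  have hproj : Projective (ModuleCat.of Aᵐᵒᵖ (LinearMap.ker π)) :=
    projective_iff_hasProjectiveDimensionLT_one.2 hker
  have hproj' : Module.Projective Aᵐᵒᵖ (LinearMap.ker π) :=
    (IsProjective.iff_projective (ModuleCat.of Aᵐᵒᵖ (LinearMap.ker π))).2 hproj
  have hmem : ∀ p, f p ∈ LinearMap.ker π := fun p => hmin.exact ▸ ⟨p, rfl⟩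
  -- As `X` has projective dimension at most one, `ker π` is projective, so its cover by `f` is an
  -- isomorphism and the presentation is a resolution.
  have hinj : Function.Injective f := by
    have hk : LinearMap.ker (f.codRestrict (LinearMap.ker π) hmem) = LinearMap.ker f :=
      LinearMap.ker_codRestrict _ _ _
    have := injective_of_isSuperfluous (f.codRestrict (LinearMap.ker π) hmem) (fun ⟨y, hy⟩ => by
      rw [← hmin.exact] at hy
      obtain ⟨x, rfl⟩ := hy
      exact ⟨x, rfl⟩) (hk ▸ hmin.superfluous)
    rwa [← LinearMap.ker_eq_bot, hk, LinearMap.ker_eq_bot] at this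
  have hS' := moduleShortComplex_shortExact f π (LinearMap.exact_iff.2 hmin.exact.symm) hinj
    hmin.cover.surjective
  have := ExtReg.subsingleton_of_hasProjectiveDimensionLT P₀ (d := 1) (n := 1) le_rfl
  let δ : (P₁ →ₗ[Aᵐᵒᵖ] A) →ₗ[A] ExtReg X 1 :=
    ExtReg.connecting hS' 0 ∘ₗ (ExtReg.ofHom P₁).toLinearMap
  have hδ : Function.Surjective δ :=
    (ExtReg.connecting_surjective hS' 0).comp (ExtReg.ofHom P₁).surjective
  -- Exactness of `Hom(P₀, A) → Hom(P₁, A) → Ext¹(X, A)` at the middle term.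
  have hkδ : LinearMap.range (LinearMap.lcomp A A f) = LinearMap.ker δ := by
    ext g
    constructor
    · rintro ⟨g, rfl⟩
      refine (ExtReg.exact_pullback_connecting hS' 0 _).2 ⟨ExtReg.ofHom P₀ g, ?_⟩
      exact ExtReg.pullback_ofHom (ModuleCat.ofHom f) g
    · intro hg
      obtain ⟨η, hη⟩ := (ExtReg.exact_pullback_connecting hS' 0 _).1 hg
      obtain ⟨g', rfl⟩ := (ExtReg.ofHom P₀).surjective η
      exact ⟨g', (ExtReg.ofHom P₁).injective
        ((ExtReg.pullback_ofHom (ModuleCat.ofHom f) g').symm.trans hη)⟩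
  exact ⟨e.trans ((Submodule.quotEquivOfEq _ _ hkδ).trans (δ.quotKerEquivOfSurjective hδ))⟩

/-- If `M` has projective dimension at most `r`, then its `r`-Auslander-Reiten translate is
the dual of `Ext^r(M, A)`. -/
lemma IsARTranslate.nonempty_equiv {K : Type u} [Field K] [Algebra K A] {r : ℕ}
    {M N : ModuleCat.{u} Aᵐᵒᵖ} (h : IsARTranslate K r M N) [hM : HasProjectiveDimensionLT M (r + 1)] :
    Nonempty (N ≃ₗ[Aᵐᵒᵖ] KDual K A (ExtReg M r)) := by
  obtain ⟨hr, X, T, hX, hT, ⟨e⟩⟩ := h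
  obtain ⟨hExt, hpd⟩ := hX.ext_shift
  have := hpd 1 (by rwa [show 1 + 1 + (r - 1) = r + 1 by lia])
  obtain ⟨e₁⟩ := hT.nonempty_equiv_ext
  obtain ⟨e₂⟩ := hExt 0
  rw [show 0 + 1 + (r - 1) = r by lia] at e₂
  exact ⟨e.trans (KDual.congr (e₁.trans e₂))⟩

end SyzygyTranspose

/-! ### Existence of projective covers over Artinian rings -/

section ProjectiveCover

variable {R : Type u} [Ring R] [IsArtinianRing R]

/-- Take a finite projective `P` of minimal length mapping onto `M`. If a proper `U` satisfied `U +
ker f = P`, then `f` would lift through `U`, giving an endomorphism of `P` over `M` with image in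
`U`. By Fitting, the image of a high power is a direct summand, hence a shorter projective that
still maps onto `M`. -/
theorem exists_isProjectiveCover (M : ModuleCat.{u} R) [Module.Finite R M] :
    ∃ (P : ModuleCat.{u} R) (f : P →ₗ[R] M), Module.Finite R P ∧ IsProjectiveCover f := by
  let Q (l : ℕ∞) : Prop := ∃ (P : ModuleCat.{u} R) (f : P →ₗ[R] M), Module.Finite R P ∧
    Module.Projective R P ∧ Function.Surjective f ∧ Module.length R P = l
  have hQ : ∃ l, Q l := by
    obtain ⟨n, f, hf⟩ := Module.Finite.exists_fin' R M
    exact ⟨_, ModuleCat.of R (Fin n → R), f, inferInstanceAs (Module.Finite R (Fin n → R)),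
      inferInstanceAs (Module.Projective R (Fin n → R)), hf, rfl⟩
  obtain ⟨l, ⟨P, f, hfin, hproj, hf, rfl⟩, hmin⟩ := WellFounded.has_min wellFounded_lt {l | Q l} hQ
  refine ⟨P, f, hfin, hproj, hf, fun U hU => by_contra fun hne => ?_⟩
  have hsurj : Function.Surjective (f ∘ₗ U.subtype) := by
    rw [← LinearMap.range_eq_top, LinearMap.range_comp, Submodule.range_subtype, eq_top_iff,
      ← LinearMap.range_eq_top.2 hf, LinearMap.range_eq_map, ← hU, Submodule.map_sup]
    refine sup_le le_rfl ?_
    rintro _ ⟨x, hx, rfl⟩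
    rw [SetLike.mem_coe, LinearMap.mem_ker] at hx
    rw [hx]
    exact zero_mem _
  obtain ⟨h, hh⟩ := Module.projective_lifting_property (f ∘ₗ U.subtype) f hsurj
  let h' : P →ₗ[R] P := U.subtype ∘ₗ h
  have hpow : ∀ n x, f ((h' ^ n) x) = f x := fun n => by
    induction n with
    | zero => intro x; rfl
    | succ n ih =>
      intro x
      rw [pow_succ, Module.End.mul_apply, ih]
      exact LinearMap.congr_fun hh x
  -- Fitting decomposition; `n ≥ 1` is needed for the range of the power to lie in `U`.
  obtain ⟨n, hn⟩ := ((LinearMap.eventually_isCompl_ker_pow_range_pow h').and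
    (Filter.eventually_ge_atTop 1)).exists
  have hrange : LinearMap.range (h' ^ n) ≤ U := by
    obtain ⟨k, rfl⟩ := Nat.exists_eq_succ_of_ne_zero (by lia : n ≠ 0)
    rintro _ ⟨x, rfl⟩
    rw [Nat.succ_eq_add_one, pow_succ', Module.End.mul_apply]
    exact (h _).2
  refine hmin (Module.length R (LinearMap.range (h' ^ n)))
    ⟨ModuleCat.of R (LinearMap.range (h' ^ n)), f ∘ₗ Submodule.subtype _,
      inferInstanceAs (Module.Finite R (LinearMap.range (h' ^ n))), ?_, ?_, rfl⟩
    (Submodule.length_lt fun htop => hne (eq_top_iff.2 (htop.ge.trans hrange)))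
  · exact Module.Projective.of_split (LinearMap.range (h' ^ n)).subtype
      (Submodule.projectionOnto _ _ hn.1.symm)
      (LinearMap.ext fun x => Submodule.projectionOnto_apply_left hn.1.symm x)
  · intro m
    obtain ⟨x, rfl⟩ := hf m
    exact ⟨⟨(h' ^ n) x, x, rfl⟩, hpow n x⟩

theorem exists_isSyzygy (M : ModuleCat.{u} R) [Module.Finite R M] :
    ∀ n : ℕ, ∃ X : ModuleCat.{u} R, Module.Finite R X ∧ IsSyzygy n M X
  | 0 => ⟨M, inferInstance, ⟨LinearEquiv.refl R M⟩⟩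
  | n + 1 => by
    obtain ⟨X, hX, hsyz⟩ := exists_isSyzygy M n
    obtain ⟨P, f, hP, hf⟩ := exists_isProjectiveCover X
    exact ⟨ModuleCat.of R (LinearMap.ker f), inferInstanceAs (Module.Finite R (LinearMap.ker f)),
      X, P, f, hsyz, hf, ⟨LinearEquiv.refl R _⟩⟩

theorem exists_isMinimalPresentation (M : ModuleCat.{u} R) [Module.Finite R M] :
    ∃ (P₁ P₀ : ModuleCat.{u} R) (f : P₁ →ₗ[R] P₀) (π : P₀ →ₗ[R] M),
      IsMinimalPresentation f π := by
  obtain ⟨P₀, π, hP₀, hπ⟩ := exists_isProjectiveCover M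
  have : Module.Finite R (ModuleCat.of R (LinearMap.ker π)) :=
    inferInstanceAs (Module.Finite R (LinearMap.ker π))
  obtain ⟨P₁, f, -, hf⟩ := exists_isProjectiveCover (ModuleCat.of R (LinearMap.ker π))
  refine ⟨P₁, P₀, (LinearMap.ker π).subtype ∘ₗ f, π, hπ, ?_, hf.projective, ?_⟩
  · rw [LinearMap.range_comp, LinearMap.range_eq_top.2 hf.surjective, Submodule.map_top,
      Submodule.range_subtype]
  · rw [LinearMap.ker_comp_of_ker_eq_bot _ (Submodule.ker_subtype _)]
    exact hf.superfluous

end ProjectiveCover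

/-- Translates are described by a relation, so existence is needed to keep assertions about all of
them from being vacuous. -/
theorem exists_isARTranslate (K : Type u) {A : Type u} [Field K] [Ring A] [Algebra K A]
    [IsArtinianRing Aᵐᵒᵖ] (M : ModuleCat.{u} Aᵐᵒᵖ) [Module.Finite Aᵐᵒᵖ M] {r : ℕ} (hr : 1 ≤ r) :
    ∃ N : ModuleCat.{u} Aᵐᵒᵖ, IsARTranslate K r M N := by
  obtain ⟨X, hX, hsyz⟩ := exists_isSyzygy M (r - 1)
  obtain ⟨P₁, P₀, f, π, hf⟩ := exists_isMinimalPresentation X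
  let T : ModuleCat.{u} A :=
    ModuleCat.of A ((P₁ →ₗ[Aᵐᵒᵖ] A) ⧸ LinearMap.range (LinearMap.lcomp A A f))
  exact ⟨ModuleCat.of Aᵐᵒᵖ (KDual K A T), hr, X, T, hsyz,
    ⟨P₁, P₀, f, π, hf, ⟨LinearEquiv.refl A _⟩⟩, ⟨LinearEquiv.refl _ _⟩⟩

/-! ### Elements of the incidence algebra -/

namespace IncidenceAlgebra

variable {K L : Type*} [Field K] [PartialOrder L] [LocallyFiniteOrder L] [DecidableEq L]

lemma mul_apply_eq_sum [Fintype L] (a b : IncidenceAlgebra K L) (x y : L) :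
    (a * b) x y = ∑ z, a x z * b z y := by
  rw [mul_apply]
  refine Finset.sum_subset (Finset.subset_univ _) fun z _ hz => ?_
  rw [Finset.mem_Icc, not_and_or] at hz
  obtain h | h := hz
  · rw [apply_eq_zero_of_not_le h, zero_mul]
  · rw [apply_eq_zero_of_not_le h, mul_zero]

variable (K) in
/-- The element of the incidence algebra with row `x` given by `f` on elements above `x`, and
all other rows zero. -/
noncomputable def row (x : L) (f : L → K) : IncidenceAlgebra K L where
  toFun a b := if a = x then (Set.Ici x).indicator f b else 0
  eq_zero_of_not_le' a b h := by
    split_ifs with hx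
    · subst hx
      exact Set.indicator_of_notMem h f
    · rfl

/-- The element of the incidence algebra with column `y` given by `f` on elements below `y`, and
all other columns zero. -/
noncomputable def col (y : L) (f : L → K) : IncidenceAlgebra K L where
  toFun a b := if b = y then (Set.Iic y).indicator f a else 0
  eq_zero_of_not_le' a b h := by
    split_ifs with hx
    · subst hx
      exact Set.indicator_of_notMem (s := Set.Iic b) h f
    · rfl

lemma row_apply (x : L) (f : L → K) (a b : L) :
    row K x f a b = if a = x then (Set.Ici x).indicator f b else 0 := rfl

lemma col_apply (y : L) (f : L → K) (a b : L) :
    col y f a b = if b = y then (Set.Iic y).indicator f a else 0 := rfl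

variable (K) in
/-- The basis element of the incidence algebra at `x ≤ y` (zero if `¬ x ≤ y`). -/
noncomputable def basisElt (x y : L) : IncidenceAlgebra K L := col y (Pi.single x 1)

lemma basisElt_apply_of_le {x y : L} (h : x ≤ y) (a b : L) :
    basisElt K x y a b = if a = x ∧ b = y then 1 else 0 := by
  rw [basisElt, col_apply]
  by_cases hb : b = y
  · by_cases ha : a = x
    · subst ha
      simp [hb, Set.indicator, h]
    · simp [hb, Set.indicator, ha]
  · simp [hb]

lemma mul_basisElt_apply [Fintype L] {x y : L} (h : x ≤ y) (a : IncidenceAlgebra K L) (z w : L) :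
    (a * basisElt K x y) z w = if w = y then a z x else 0 := by
  rw [mul_apply_eq_sum]
  simp only [basisElt_apply_of_le h]
  by_cases hw : w = y <;> simp [hw]

lemma basisElt_mul_apply [Fintype L] {x y : L} (h : x ≤ y) (a : IncidenceAlgebra K L) (z w : L) :
    (basisElt K x y * a) z w = if z = x then a y w else 0 := by
  rw [mul_apply_eq_sum]
  simp only [basisElt_apply_of_le h]
  by_cases hw : z = x <;> simp [hw]

end IncidenceAlgebra

/-! ### Modules supported on convex sets -/

section IntervalModule

variable (K : Type u) {L : Type u} [Field K] [PartialOrder L]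

/-- Functions on `L` supported on `C`; for convex `C`, this is a right module over the incidence
algebra of `L`. -/
def IntervalModule (C : Set L) : Type u :=
  {f : L → K // ∀ z ∉ C, f z = 0}

namespace IntervalModule

variable {K} {C D : Set L}

noncomputable instance : AddCommGroup (IntervalModule K C) :=
  inferInstanceAs (AddCommGroup ({
    carrier := {f : L → K | ∀ z ∉ C, f z = 0}
    add_mem' := fun hf hg z hz => by simp [hf z hz, hg z hz]
    zero_mem' := fun _ _ => rfl
    neg_mem' := fun hf z hz => by simp [hf z hz] } : AddSubgroup (L → K)))

@[ext] lemma ext {f g : IntervalModule K C} (h : ∀ z ∈ C, f.1 z = g.1 z) : f = g :=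
  Subtype.ext (funext fun z => by
    by_cases hz : z ∈ C
    · exact h z hz
    · rw [f.2 z hz, g.2 z hz])

lemma zero_val : (0 : IntervalModule K C).1 = 0 := rfl
lemma add_val (f g : IntervalModule K C) : (f + g).1 = f.1 + g.1 := rfl

/-- The restriction of a function to `C`, extended by zero. -/
noncomputable def restrict (C : Set L) (f : L → K) : IntervalModule K C :=
  ⟨C.indicator f, fun _ hz => Set.indicator_of_notMem hz f⟩

lemma restrict_val_of_mem {f : L → K} {z : L} (hz : z ∈ C) : (restrict C f).1 z = f z :=
  Set.indicator_of_mem hz f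

variable [LocallyFiniteOrder L] [DecidableEq L] [Fintype L]

noncomputable instance : SMul (IncidenceAlgebra K L)ᵐᵒᵖ (IntervalModule K C) where
  smul a f := restrict C fun y => ∑ z, f.1 z * a.unop z y

lemma smul_val (a : (IncidenceAlgebra K L)ᵐᵒᵖ) (f : IntervalModule K C) {y : L} (hy : y ∈ C) :
    (a • f).1 y = ∑ z, f.1 z * a.unop z y := restrict_val_of_mem hy

noncomputable instance [hC : C.OrdConnected] :
    Module (IncidenceAlgebra K L)ᵐᵒᵖ (IntervalModule K C) where
  one_smul f := ext fun y hy => by simp [smul_val _ _ hy]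
  mul_smul a b f := ext fun y hy => by
    rw [smul_val _ _ hy, smul_val _ _ hy]
    simp only [MulOpposite.unop_mul, IncidenceAlgebra.mul_apply_eq_sum, Finset.mul_sum]
    rw [Finset.sum_comm]
    refine Finset.sum_congr rfl fun w _ => ?_
    by_cases hw : w ∈ C
    · rw [smul_val _ _ hw, Finset.sum_mul]
      simp only [mul_assoc]
    · rw [(b • f).2 w hw, zero_mul]
      refine Finset.sum_eq_zero fun z _ => ?_
      by_cases hz : z ∈ C
      · by_cases hzw : z ≤ w
        · have hwy : ¬ w ≤ y := fun hwy => hw (hC.out hz hy ⟨hzw, hwy⟩)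
          rw [IncidenceAlgebra.apply_eq_zero_of_not_le hwy, mul_zero, mul_zero]
        · rw [IncidenceAlgebra.apply_eq_zero_of_not_le hzw, zero_mul, mul_zero]
      · rw [f.2 z hz, zero_mul]
  smul_zero a := ext fun y hy => by simp [smul_val _ _ hy, zero_val]
  smul_add a f g := ext fun y hy => by
    simp [smul_val _ _ hy, add_val, add_mul, Finset.sum_add_distrib]
  add_smul a b f := ext fun y hy => by
    simp [smul_val _ _ hy, add_val, mul_add, Finset.sum_add_distrib]
  zero_smul f := ext fun y hy => by simp [smul_val _ _ hy, zero_val]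

/-- The map between modules supported on `C` and `D` which is the identity over `C ∩ D`. It is
linear if `C ∩ D` is closed downwards in `C` and upwards in `D`. -/
noncomputable def map [C.OrdConnected] [D.OrdConnected]
    (h₁ : ∀ z ∈ C, ∀ y ∈ C, y ∈ D → z ≤ y → z ∈ D)
    (h₂ : ∀ z ∈ C, z ∈ D → ∀ y ∈ D, z ≤ y → y ∈ C) :
    IntervalModule K C →ₗ[(IncidenceAlgebra K L)ᵐᵒᵖ] IntervalModule K D where
  toFun f := restrict D f.1
  map_add' f g := ext fun y hy => by
    simp [restrict_val_of_mem hy, add_val]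
  map_smul' a f := ext fun y hy => by
    rw [restrict_val_of_mem hy, RingHom.id_apply, smul_val _ _ hy]
    by_cases hC : y ∈ C
    · rw [smul_val _ _ hC]
      refine Finset.sum_congr rfl fun z _ => ?_
      by_cases hD : z ∈ D
      · rw [restrict_val_of_mem hD]
      rw [(restrict D f.1).2 z hD, zero_mul]
      by_cases hz : z ∈ C
      · rw [IncidenceAlgebra.apply_eq_zero_of_not_le fun hzy => hD (h₁ z hz y hC hy hzy), mul_zero]
      · rw [f.2 z hz, zero_mul]
    · rw [(a • f).2 y hC]
      refine (Finset.sum_eq_zero fun z _ => ?_).symm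
      by_cases hD : z ∈ D
      · rw [restrict_val_of_mem hD]
        by_cases hz : z ∈ C
        · rw [IncidenceAlgebra.apply_eq_zero_of_not_le fun hzy => hC (h₂ z hz hD y hy hzy),
            mul_zero]
        · rw [f.2 z hz, zero_mul]
      · rw [(restrict D f.1).2 z hD, zero_mul]

variable {x : L} [C.OrdConnected]

/-- A function supported on the elements above `x`, as row `x` of an element of the incidence
algebra. -/
noncomputable def toRow (hC : C = Set.Ici x) :
    IntervalModule K C →ₗ[(IncidenceAlgebra K L)ᵐᵒᵖ] IncidenceAlgebra K L where
  toFun f := IncidenceAlgebra.row K x f.1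
  map_add' f g := by
    ext a b
    simp only [IncidenceAlgebra.row_apply, IncidenceAlgebra.add_apply, add_val]
    split_ifs
    · rw [Set.indicator_add']; rfl
    · simp
  map_smul' r f := by
    subst hC
    ext a b hab
    change _ = (IncidenceAlgebra.row K x f.1 * r.unop) a b
    rw [IncidenceAlgebra.mul_apply_eq_sum]
    simp only [IncidenceAlgebra.row_apply]
    split_ifs with ha
    · subst ha
      rw [Set.indicator_of_mem (show b ∈ Set.Ici a from hab)]
      refine (smul_val r f hab).trans ?_
      refine Finset.sum_congr rfl fun z _ => ?_
      by_cases hz : z ∈ Set.Ici a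
      · rw [Set.indicator_of_mem hz]
      · rw [Set.indicator_of_notMem hz, f.2 z hz]
    · simp

lemma toRow_apply (hC : C = Set.Ici x) (f : IntervalModule K C) (a b : L) :
    toRow hC f a b = if a = x then f.1 b else 0 := by
  subst hC
  change IncidenceAlgebra.row K x f.1 a b = _
  rw [IncidenceAlgebra.row_apply,
    Set.indicator_eq_self.2 fun z hz => by_contra fun h => hz (f.2 z h)]

/-- The row `x` of an element of the incidence algebra. -/
noncomputable def ofRow (hC : C = Set.Ici x) :
    IncidenceAlgebra K L →ₗ[(IncidenceAlgebra K L)ᵐᵒᵖ] IntervalModule K C where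
  toFun a := restrict C (a x)
  map_add' a b := ext fun y hy => by simp [restrict_val_of_mem hy, add_val]
  map_smul' r a := ext fun y hy => by
    subst hC
    rw [RingHom.id_apply, smul_val _ _ hy, restrict_val_of_mem hy]
    change (a * r.unop) x y = _
    rw [IncidenceAlgebra.mul_apply_eq_sum]
    refine Finset.sum_congr rfl fun z _ => ?_
    by_cases hz : z ∈ Set.Ici x
    · rw [restrict_val_of_mem hz]
    · rw [(restrict _ (a x)).2 z hz, IncidenceAlgebra.apply_eq_zero_of_not_le hz]

/-- Extracting row `x` splits the embedding of the module as row `x` of the algebra. The set is kept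
as a variable with an equation because it will be `joinRegion [] x`, which equals `Set.Ici x` only
propositionally. -/
lemma projective (hC : C = Set.Ici x) :
    Module.Projective (IncidenceAlgebra K L)ᵐᵒᵖ (IntervalModule K C) :=
  haveI : Module.Projective (IncidenceAlgebra K L)ᵐᵒᵖ (IncidenceAlgebra K L) :=
    Module.Projective.of_equiv (M := (IncidenceAlgebra K L)ᵐᵒᵖ) (σ := RingHom.id _)
      { toFun := MulOpposite.unop
        invFun := MulOpposite.op
        left_inv := fun _ => rfl
        right_inv := fun _ => rfl
        map_add' := fun _ _ => rfl
        map_smul' := fun _ _ => rfl }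
  Module.Projective.of_split (toRow hC) (ofRow hC) (LinearMap.ext fun f => ext fun y hy => by
    change (restrict C (toRow hC f x)).1 y = f.1 y
    rw [restrict_val_of_mem hy, toRow_apply, if_pos rfl])

/-- A right module map from the projective module at `x` to the incidence algebra is determined
by an element of the incidence algebra. -/
lemma exists_eq_mul_toRow (hC : C = Set.Ici x)
    (φ : IntervalModule K C →ₗ[(IncidenceAlgebra K L)ᵐᵒᵖ] IncidenceAlgebra K L) :
    ∃ a : IncidenceAlgebra K L, ∀ f, φ f = a * toRow hC f := by
  -- The indicator of `x` generates the module, so its image under `φ` determines `φ`.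
  refine ⟨φ (restrict C (Pi.single x 1)), fun f => ?_⟩
  have hf : f = MulOpposite.op (toRow hC f) • restrict C (Pi.single x 1) := ext fun y hy => by
    rw [smul_val _ _ hy, Finset.sum_eq_single x]
    · rw [restrict_val_of_mem (by simp [hC]), MulOpposite.unop_op, toRow_apply, if_pos rfl,
        Pi.single_eq_same, one_mul]
    · intro z _ hz
      rw [MulOpposite.unop_op, toRow_apply, if_neg hz, mul_zero]
    · simp
  conv_lhs => rw [hf, map_smul]
  rfl

/-- The product has entries `a z x * f w`, so only column `x` of `a` matters, and testing on the
indicator of `x` recovers it. -/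
lemma mul_toRow_eq_zero_iff (hC : C = Set.Ici x) (a : IncidenceAlgebra K L) :
    (∀ f : IntervalModule K C, a * toRow hC f = 0) ↔ ∀ z ≤ x, a z x = 0 := by
  have key : ∀ (f : IntervalModule K C) z w, (a * toRow hC f) z w = a z x * f.1 w :=
    fun f z w => by
      rw [IncidenceAlgebra.mul_apply_eq_sum, Finset.sum_eq_single x]
      · rw [toRow_apply, if_pos rfl]
      · intro y _ hy
        rw [toRow_apply, if_neg hy, mul_zero]
      · simp
  constructor
  · intro h z _
    have := key (restrict C (Pi.single x 1)) z x
    rw [h, restrict_val_of_mem (by simp [hC]), Pi.single_eq_same, mul_one] at this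
    exact this.symm
  · intro h f
    ext z w _
    rw [key]
    by_cases hz : z ≤ x
    · rw [h z hz, zero_mul]; rfl
    · rw [IncidenceAlgebra.apply_eq_zero_of_not_le hz, zero_mul]; rfl

end IntervalModule

end IntervalModule

/-! ### Iterated joins -/

section Join

variable {L : Type u} [Lattice L]

/-- The elements above `x` which are not above any element of `T`. -/
def joinRegion (T : List L) (x : L) : Set L := {y | x ≤ y ∧ ∀ t ∈ T, ¬ t ≤ y}

instance (T : List L) (x : L) : (joinRegion T x).OrdConnected :=
  ⟨fun _ ha _ hb _ hy => ⟨ha.1.trans hy.1, fun t ht h => hb.2 t ht (h.trans hy.2)⟩⟩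

lemma joinRegion_nil (x : L) : joinRegion [] x = Set.Ici x := by
  ext y; simp [joinRegion]

/-- The join of `x` and all elements of `T`. -/
def listJoin : List L → L → L
  | [], x => x
  | t :: T, x => listJoin T (x ⊔ t)

lemma listJoin_mono : ∀ (T : List L) {x y : L}, x ≤ y → listJoin T x ≤ listJoin T y
  | [], _, _, h => h
  | t :: T, _, _, h => listJoin_mono T (sup_le_sup_right h t)

/-- The elements below the join of `x` and `T`, but not below any join omitting an element
of `T`. -/
def essentialSet : List L → L → Set L
  | [], x => Set.Iic x
  | t :: T, x => {z | z ∈ essentialSet T (x ⊔ t) ∧ ¬ z ≤ listJoin T x}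

/-- The hereditary condition on `x` and `T` under which `Ext` of the iterated quotient is
concentrated in a single degree. -/
def IsJoinIndependent : List L → L → Prop
  | [], _ => True
  | t :: T, x => IsJoinIndependent T x ∧ IsJoinIndependent T (x ⊔ t) ∧
      essentialSet T x ⊆ essentialSet T (x ⊔ t)

end Join

/-! ### Extension classes of iterated quotients of projective modules -/

section Koszul

variable (K : Type u) {L : Type u} [Field K] [Lattice L] [LocallyFiniteOrder L] [DecidableEq L]
  [Fintype L]

/-- The quotient of the projective module at `x` by the images of the projective modules at
`x ⊔ t`, for `t ∈ T`. -/
noncomputable abbrev koszulModule (T : List L) (x : L) : ModuleCat.{u} (IncidenceAlgebra K L)ᵐᵒᵖ :=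
  ModuleCat.of _ (IntervalModule K (joinRegion T x))

/-- The inclusion of `koszulModule K T y` in `koszulModule K T x`, for `x ≤ y`. -/
noncomputable def koszulInclusion (T : List L) {x y : L} (h : x ≤ y) :
    koszulModule K T y ⟶ koszulModule K T x :=
  ModuleCat.ofHom (IntervalModule.map
    (fun _ hz _ _ _ _ => ⟨h.trans hz.1, hz.2⟩)
    (fun _ hz _ _ hy hzy => ⟨hz.1.trans hzy, hy.2⟩))

/-- The projection of `koszulModule K T x` onto `koszulModule K (t :: T) x`. -/
noncomputable def koszulProjection (T : List L) (t x : L) :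
    koszulModule K T x ⟶ koszulModule K (t :: T) x :=
  ModuleCat.ofHom (IntervalModule.map
    (fun _ hz _ _ hy hzy => ⟨hz.1, fun s hs h => hy.2 s hs (h.trans hzy)⟩)
    (fun _ _ hz _ hy hzy => ⟨hz.1.trans hzy, fun s hs => hy.2 s (List.mem_cons_of_mem t hs)⟩))

variable {K}

lemma koszulInclusion_val (T : List L) {x y : L} (h : x ≤ y) (f : koszulModule K T y) :
    (koszulInclusion K T h f).1 = f.1 :=
  Set.indicator_eq_self.2 fun z hz => by
    have hz' : z ∈ joinRegion T y := by_contra fun hn => hz (f.2 z hn)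
    exact ⟨h.trans hz'.1, hz'.2⟩

lemma koszulInclusion_apply (T : List L) {x y : L} (h : x ≤ y) (f : koszulModule K T y) (z : L) :
    (koszulInclusion K T h f).1 z = f.1 z := congrFun (koszulInclusion_val T h f) z

lemma koszulProjection_apply (T : List L) (t x : L) (f : koszulModule K T x)
    {z : L} (hz : z ∈ joinRegion (t :: T) x) :
    (koszulProjection K T t x f).1 z = f.1 z := IntervalModule.restrict_val_of_mem hz

/-- The points lost in passing from `T` to `t :: T` are those above both `x` and `t` and above no
element of `T`, which is exactly the region of `T` at `x ⊔ t`. -/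
lemma exact_koszul (T : List L) (t x : L) :
    Function.Exact (koszulInclusion K T (le_sup_left : x ≤ x ⊔ t)).hom
      (koszulProjection K T t x).hom := by
  intro f
  constructor
  · intro h
    refine ⟨IntervalModule.restrict _ f.1, IntervalModule.ext fun z hz => ?_⟩
    refine (koszulInclusion_apply T _ _ z).trans ?_
    by_cases ht : t ≤ z
    · exact IntervalModule.restrict_val_of_mem ⟨sup_le hz.1 ht, hz.2⟩
    · rw [(IntervalModule.restrict _ f.1).2 z fun hz' => ht (le_sup_right.trans hz'.1)]
      have hz' : z ∈ joinRegion (t :: T) x := ⟨hz.1, by simpa using ⟨ht, hz.2⟩⟩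
      rw [← koszulProjection_apply T t x f hz']
      exact (congrFun (congrArg Subtype.val h) z).symm
  · rintro ⟨g, rfl⟩
    refine IntervalModule.ext fun z hz => ?_
    refine (koszulProjection_apply T t x _ hz).trans
      ((koszulInclusion_apply T _ g z).trans ?_)
    exact g.2 z fun hz' => hz.2 t (by simp) (le_sup_right.trans hz'.1)

variable (K) in
/-- The short complex relating the modules for `T` and for `t :: T`. -/
noncomputable abbrev koszulSequence (T : List L) (t x : L) :
    ShortComplex (ModuleCat.{u} (IncidenceAlgebra K L)ᵐᵒᵖ) :=
  moduleShortComplex (koszulInclusion K T (le_sup_left : x ≤ x ⊔ t)).hom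
    (koszulProjection K T t x).hom (exact_koszul T t x)

lemma shortExact_koszulSequence (T : List L) (t x : L) : (koszulSequence K T t x).ShortExact := by
  refine moduleShortComplex_shortExact _ _ _ (fun f g h => IntervalModule.ext fun z hz => ?_)
    fun f => ⟨IntervalModule.restrict _ f.1, IntervalModule.ext fun z hz => ?_⟩
  · exact (koszulInclusion_apply T _ f z).symm.trans
      ((congrFun (congrArg Subtype.val h) z).trans (koszulInclusion_apply T _ g z))
  · exact (koszulProjection_apply T t x _ hz).trans
      (IntervalModule.restrict_val_of_mem ⟨hz.1, fun s hs => hz.2 s (by simp [hs])⟩)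

variable (K) in
/-- The inclusion of one sequence of iterated quotients in another. -/
noncomputable def koszulSequenceMap (T : List L) (t : L) {x y : L} (h : x ≤ y) :
    koszulSequence K T t y ⟶ koszulSequence K T t x where
  τ₁ := koszulInclusion K T (sup_le_sup_right h t)
  τ₂ := koszulInclusion K T h
  τ₃ := koszulInclusion K (t :: T) h
  comm₁₂ := ModuleCat.hom_ext (LinearMap.ext fun f => Subtype.ext <|
    ((koszulInclusion_val T le_sup_left (koszulInclusion K T (sup_le_sup_right h t) f)).trans
      (koszulInclusion_val T (sup_le_sup_right h t) f)).trans
    ((koszulInclusion_val T h (koszulInclusion K T le_sup_left f)).trans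
      (koszulInclusion_val T le_sup_left f)).symm)
  comm₂₃ := ModuleCat.hom_ext (LinearMap.ext fun f => IntervalModule.ext fun z hz => by
    change (koszulProjection K T t x (koszulInclusion K T h f)).1 z =
      (koszulInclusion K (t :: T) h (koszulProjection K T t y f)).1 z
    rw [koszulProjection_apply T t x _ hz, koszulInclusion_apply, koszulInclusion_apply]
    by_cases hy : y ≤ z
    · exact (koszulProjection_apply T t y _ ⟨hy, hz.2⟩).symm
    · exact (f.2 z fun h => hy h.1).trans ((koszulProjection K T t y f).2 z fun h => hy h.1).symm)

variable (K) in
/-- The generator of the top-degree `Ext` module of `koszulModule K T x`. -/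
noncomputable def koszulClass : (T : List L) → (x : L) → ExtReg (koszulModule K T x) T.length
  | [], x => ExtReg.ofHom (koszulModule K [] x) (IntervalModule.toRow (joinRegion_nil x))
  | t :: T, x => ExtReg.connecting (shortExact_koszulSequence T t x) T.length
      (koszulClass T (x ⊔ t))

/-- The start is projective, and each further element of the list raises the bound by one; no
independence of the list is needed. -/
instance hasProjectiveDimensionLT_koszulModule : ∀ (T : List L) (x : L),
    HasProjectiveDimensionLT (koszulModule K T x) (T.length + 1)
  | [], x => by
    have := (IsProjective.iff_projective (koszulModule K [] x)).1
      (IntervalModule.projective (joinRegion_nil x))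
    exact inferInstanceAs (HasProjectiveDimensionLT (koszulModule K [] x) 1)
  | t :: T, x => (shortExact_koszulSequence T t x).hasProjectiveDimensionLT_X₃ (T.length + 1)
      (hasProjectiveDimensionLT_koszulModule T (x ⊔ t))
      (have := hasProjectiveDimensionLT_koszulModule T x
       hasProjectiveDimensionLT_of_ge (koszulModule K T x) (T.length + 1) _ (Nat.le_succ _))

/-- For the empty list, including the projective at `y` in that at `x` amounts to left
multiplication of rows by the basis element at `x ≤ y`. Naturality and linearity of the connecting
maps propagate this. -/
lemma pullback_koszulClass : ∀ (T : List L) {x y : L} (h : x ≤ y),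
    ExtReg.pullback (koszulInclusion K T h) T.length (koszulClass K T x) =
      IncidenceAlgebra.basisElt K (listJoin T x) (listJoin T y) • koszulClass K T y
  | [], x, y, h => by
    refine (ExtReg.pullback_ofHom _ _).trans
      (Eq.trans (congrArg _ (LinearMap.ext fun f => ?_)) (map_smul (ExtReg.ofHom _) _ _))
    change IntervalModule.toRow (joinRegion_nil x) (koszulInclusion K [] h f) =
      IncidenceAlgebra.basisElt K x y * IntervalModule.toRow (joinRegion_nil y) f
    ext a b hab
    rw [IncidenceAlgebra.basisElt_mul_apply h, IntervalModule.toRow_apply,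
      IntervalModule.toRow_apply, if_pos rfl]
    split_ifs with ha
    · subst ha
      exact koszulInclusion_apply [] h f b
    · rfl
  | t :: T, x, y, h => by
    refine (ExtReg.connecting_naturality (shortExact_koszulSequence T t y)
      (shortExact_koszulSequence T t x) (koszulSequenceMap K T t h) T.length _).trans ?_
    refine (congrArg _ (pullback_koszulClass T (sup_le_sup_right h t))).trans ?_
    exact map_smul (ExtReg.connecting (shortExact_koszulSequence T t y) T.length) _ _

/-- Homomorphisms from the projective at `x` to `A` are multiples of the row embedding, and the
connecting map is onto because the middle term has no Ext in degree `|T| + 1`. -/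
theorem exists_smul_koszulClass : ∀ (T : List L) (x : L) (η : ExtReg (koszulModule K T x) T.length),
    ∃ a : IncidenceAlgebra K L, a • koszulClass K T x = η
  | [], x, η => by
    obtain ⟨φ, rfl⟩ := (ExtReg.ofHom (koszulModule K [] x)).surjective η
    obtain ⟨a, ha⟩ := IntervalModule.exists_eq_mul_toRow (joinRegion_nil x) φ
    exact ⟨a, (map_smul (ExtReg.ofHom (koszulModule K [] x)) a _).symm.trans
      (congrArg _ (LinearMap.ext fun f => (ha f).symm))⟩
  | t :: T, x, η => by
    have : Subsingleton (ExtReg (koszulSequence K T t x).X₂ (T.length + 1)) :=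
      ExtReg.subsingleton_of_hasProjectiveDimensionLT (koszulModule K T x) le_rfl
    obtain ⟨η, rfl⟩ := ExtReg.connecting_surjective (shortExact_koszulSequence T t x) T.length η
    obtain ⟨a, rfl⟩ := exists_smul_koszulClass T (x ⊔ t) η
    exact ⟨a, (map_smul (ExtReg.connecting (shortExact_koszulSequence T t x) T.length) a _).symm⟩

/-- A class dies under the connecting map iff it is pulled back from `M(T, x)`, that is, iff on the
essential set of `T` at `x ⊔ t` the relevant column of `a` agrees with the column of some `b` at
`listJoin T x`. Such a column is arbitrary below `listJoin T x` and zero elsewhere, so the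
obstruction is the part of the essential set not below it. -/
theorem smul_koszulClass_eq_zero_iff : ∀ (T : List L) (x : L) (a : IncidenceAlgebra K L),
    a • koszulClass K T x = 0 ↔ ∀ z ∈ essentialSet T x, a z (listJoin T x) = 0
  | [], x, a => by
    refine Iff.trans ?_ (IntervalModule.mul_toRow_eq_zero_iff (joinRegion_nil x) a)
    have h := map_smul (ExtReg.ofHom (koszulModule K [] x)) a
      (IntervalModule.toRow (joinRegion_nil x))
    refine Iff.trans (Eq.congr_left h.symm) ?_
    rw [LinearEquiv.map_eq_zero_iff, LinearMap.ext_iff]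
    rfl
  | t :: T, x, a => by
    have hle := listJoin_mono T (le_sup_left : x ≤ x ⊔ t)
    have h := map_smul (ExtReg.connecting (shortExact_koszulSequence T t x) T.length) a
      (koszulClass K T (x ⊔ t))
    refine Iff.trans (Eq.congr_left h.symm) ?_
    rw [ExtReg.exact_pullback_connecting (shortExact_koszulSequence T t x) T.length]
    have key : ∀ b : IncidenceAlgebra K L,
        ExtReg.pullback (koszulSequence K T t x).f T.length (b • koszulClass K T x) =
          a • koszulClass K T (x ⊔ t) ↔
        ∀ z ∈ essentialSet T (x ⊔ t), b z (listJoin T x) = a z (listJoin T (x ⊔ t)) := fun b => by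
      rw [map_smul]
      have hp := pullback_koszulClass (K := K) T (le_sup_left : x ≤ x ⊔ t)
      refine Iff.trans (Eq.congr_left (congrArg (b • ·) hp)) ?_
      dsimp only
      rw [← mul_smul, ← sub_eq_zero, ← sub_smul, smul_koszulClass_eq_zero_iff T (x ⊔ t)]
      refine forall₂_congr fun z _ => ?_
      rw [IncidenceAlgebra.sub_apply, IncidenceAlgebra.mul_basisElt_apply hle, if_pos rfl,
        sub_eq_zero]
    constructor
    · rintro ⟨η, hη⟩ z ⟨hz, hz'⟩
      obtain ⟨b, rfl⟩ := exists_smul_koszulClass T x η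
      exact ((key b).1 hη z hz).symm.trans (IncidenceAlgebra.apply_eq_zero_of_not_le hz' b)
    · intro ha
      -- The preimage copies the column of `a` at the larger join into the column at the smaller
      -- one, truncated to where that column may be nonzero.
      refine ⟨IncidenceAlgebra.col (listJoin T x) (fun z => a z (listJoin T (x ⊔ t))) •
        koszulClass K T x, (key _).2 fun z hz => ?_⟩
      rw [IncidenceAlgebra.col_apply, if_pos rfl]
      by_cases hzx : z ≤ listJoin T x
      · exact Set.indicator_of_mem (s := Set.Iic (listJoin T x)) hzx _
      · rw [Set.indicator_of_notMem (s := Set.Iic (listJoin T x)) hzx]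
        exact (ha z ⟨hz, hzx⟩).symm

/-- In the long exact sequence the only neighbours not zero by induction occur in degree `|T|`.
There the pullback from `M(T, x)` to `M(T, x ⊔ t)` moves a column along a basis element, and it is
injective because the annihilating conditions at `x ⊔ t` include those at `x`. -/
theorem subsingleton_extReg_koszulModule : ∀ (T : List L) (x : L), IsJoinIndependent T x →
    ∀ n < T.length, Subsingleton (ExtReg (koszulModule K T x) n)
  | [], _, _, n, hn => absurd hn (Nat.not_lt_zero n)
  | t :: T, x, ⟨hx, hxt, hsub⟩, n, hn => by
    have hS := shortExact_koszulSequence (K := K) T t x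
    have hg : ∀ η : ExtReg (koszulModule K (t :: T) x) n,
        ExtReg.pullback (koszulSequence K T t x).g n η = 0 := fun η => by
      obtain hn | rfl := Nat.lt_succ_iff_lt_or_eq.1 hn
      · have := subsingleton_extReg_koszulModule T x hx n hn
        exact Subsingleton.elim (α := ExtReg (koszulModule K T x) n) _ _
      · have h0 : ExtReg.pullback (koszulSequence K T t x).f T.length
            (ExtReg.pullback (koszulSequence K T t x).g T.length η) = 0 :=
          (ExtReg.exact_pullback_pullback hS T.length).apply_apply_eq_zero η
        obtain ⟨b, hb⟩ := exists_smul_koszulClass T x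
          (ExtReg.pullback (koszulSequence K T t x).g T.length η)
        rw [← hb, map_smul] at h0
        have hp := pullback_koszulClass (K := K) T (le_sup_left : x ≤ x ⊔ t)
        have h1 := (congrArg (b • ·) hp).symm.trans h0
        dsimp only at h1
        rw [← mul_smul, smul_koszulClass_eq_zero_iff] at h1
        refine hb.symm.trans ((smul_koszulClass_eq_zero_iff T x b).2 fun z hz => ?_)
        have := h1 z (hsub hz)
        rwa [IncidenceAlgebra.mul_basisElt_apply (listJoin_mono T le_sup_left), if_pos rfl] at this
    refine subsingleton_of_forall_eq 0 fun η => ?_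
    -- In degree zero there is no connecting map to lift along; injectivity comes from the
    -- epimorphism instead.
    obtain _ | n := n
    · have := hS.epi_g
      exact Abelian.Ext.precomp_mk₀_injective_of_epi (regularModule (IncidenceAlgebra K L))
        (koszulSequence K T t x).g ((hg η).trans (map_zero _).symm)
    · obtain ⟨ξ, rfl⟩ := (ExtReg.exact_connecting_pullback hS n η).1 (hg η)
      have := subsingleton_extReg_koszulModule T (x ⊔ t) hxt n (by simpa using hn)
      exact (congrArg _ (Subsingleton.elim (α := ExtReg (koszulModule K T (x ⊔ t)) n) ξ 0)).trans
        (map_zero _)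

end Koszul

/-! ### Duals of cyclic modules with interval support -/

namespace KDual

variable {K A N : Type*} [Field K] [Ring A] [Algebra K A] [AddCommGroup N] [Module A N]

/-- Evaluation of a functional. -/
def eval (φ : KDual K A N) (n : N) : K := DFunLike.coe (F := RestrictScalars K A N →ₗ[K] K) φ n

lemma ext {φ ψ : KDual K A N} (h : ∀ n, φ.eval n = ψ.eval n) : φ = ψ := LinearMap.ext h

lemma add_eval (φ ψ : KDual K A N) (n : N) : (φ + ψ).eval n = φ.eval n + ψ.eval n := rfl

lemma smul_eval (a : Aᵐᵒᵖ) (φ : KDual K A N) (n : N) : (a • φ).eval n = φ.eval (a.unop • n) := rfl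

lemma eval_algebraMap_smul (φ : KDual K A N) (k : K) (n : N) :
    φ.eval (algebraMap K A k • n) = k * φ.eval n :=
  LinearMap.map_smul (M := RestrictScalars K A N) φ k n

lemma eval_sum (φ : KDual K A N) {ι : Type*} (s : Finset ι) (f : ι → N) :
    φ.eval (∑ i ∈ s, f i) = ∑ i ∈ s, φ.eval (f i) :=
  map_sum (M := RestrictScalars K A N) (show RestrictScalars K A N →ₗ[K] K from φ) f s

lemma exists_eval_eq {n : N} (hn : n ≠ 0) (k : K) : ∃ φ : KDual K A N, φ.eval n = k := by
  let : Module K N := Module.compHom N (algebraMap K A)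
  obtain ⟨φ, hφ⟩ := Module.Projective.exists_dual_eq_one K hn
  exact ⟨(k • φ : N →ₗ[K] K), (congrArg (k * ·) hφ).trans (mul_one k)⟩

end KDual

section CyclicModule

variable {K : Type u} {L : Type u} [Field K] [PartialOrder L] [LocallyFiniteOrder L]
  [DecidableEq L] [Fintype L] {N : Type u} [AddCommGroup N] [Module (IncidenceAlgebra K L) N]

open IncidenceAlgebra

/-- The dual of a cyclic left module whose support is an interval has simple top, located at the
minimum of the interval. -/
theorem nonempty_top_kDual_equiv {r c : L} (hrc : r ≤ c) (ξ : N)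
    (hgen : ∀ n : N, ∃ a : IncidenceAlgebra K L, a • ξ = n)
    (hker : ∀ a : IncidenceAlgebra K L, a • ξ = 0 ↔ ∀ z, r ≤ z → z ≤ c → a z c = 0) :
    Nonempty (ModuleTop (IncidenceAlgebra K L)ᵐᵒᵖ (KDual K (IncidenceAlgebra K L) N)
      ≃ₗ[(IncidenceAlgebra K L)ᵐᵒᵖ] SimpleAt K r) := by
  -- The action on `ξ` sees only column `c` over the interval from `r` to `c`.
  have heq : ∀ a b : IncidenceAlgebra K L, (∀ z, r ≤ z → z ≤ c → a z c = b z c) →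
      a • ξ = b • ξ := fun a b h => by
    rw [← sub_eq_zero, ← sub_smul, hker]
    intro z h₁ h₂
    rw [IncidenceAlgebra.sub_apply, h z h₁ h₂, sub_self]
  have hscal : ∀ (k : K) (a : IncidenceAlgebra K L),
      algebraMap K (IncidenceAlgebra K L) k • a • ξ = (k • a) • ξ := fun k a => by
    rw [Algebra.smul_def, mul_smul]
  have hexp : ∀ b : IncidenceAlgebra K L,
      b • ξ = ∑ w, algebraMap K (IncidenceAlgebra K L) (b w c) • basisElt K w c • ξ := fun b => by
    simp only [hscal]
    rw [← Finset.sum_smul]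
    refine heq _ _ fun z _ hz => ?_
    have : ∀ s : Finset L, (∑ w ∈ s, b w c • basisElt K w c) z c =
        ∑ w ∈ s, (b w c • basisElt K w c) z c := fun s => by
      induction s using Finset.induction_on with
      | empty => rfl
      | insert w s hw ih => rw [Finset.sum_insert hw, Finset.sum_insert hw, IncidenceAlgebra.add_apply, ih]
    rw [this, Finset.sum_eq_single z]
    · rw [constSMul_apply, basisElt_apply_of_le hz, if_pos ⟨rfl, rfl⟩, smul_eq_mul, mul_one]
    · intro w _ hw
      rw [constSMul_apply, basisElt, col_apply, if_pos rfl, Set.indicator_of_mem (Set.mem_Iic.2 hz),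
        Pi.single_eq_of_ne hw.symm, smul_zero]
    · simp
  -- This vector spans the line at the bottom of the interval; evaluation at it will be the
  -- projection of the dual onto its top.
  let v : N := basisElt K r c • ξ
  have hv : v ≠ 0 := fun h => by
    have := (hker _).1 h r le_rfl hrc
    rw [basisElt_apply_of_le hrc, if_pos ⟨rfl, rfl⟩] at this
    exact one_ne_zero this
  have hrow : ∀ a : IncidenceAlgebra K L, (∀ z, r < z → a z c = 0) →
      a • ξ = algebraMap K (IncidenceAlgebra K L) (a r c) • v := fun a ha => by
    rw [hscal]
    refine heq _ _ fun z hz _ => ?_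
    rw [constSMul_apply, basisElt_apply_of_le hrc, smul_eq_mul]
    obtain rfl | hz := hz.eq_or_lt
    · simp
    · rw [ha z hz, if_neg fun h => hz.ne' h.1, mul_zero]
  let π : KDual K (IncidenceAlgebra K L) N →ₗ[(IncidenceAlgebra K L)ᵐᵒᵖ] SimpleAt K r :=
    { toFun := fun φ => φ.eval v
      map_add' := fun φ ψ => φ.add_eval ψ v
      map_smul' := fun a φ => by
        change φ.eval (a.unop • v) = φ.eval v * a.unop r r
        rw [← mul_smul, hrow (a.unop * basisElt K r c), KDual.eval_algebraMap_smul,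
          mul_basisElt_apply hrc, if_pos rfl, mul_comm]
        intro z hz
        rw [mul_basisElt_apply hrc, if_pos rfl, apply_eq_zero_of_not_le hz.not_ge] }
  have : Nontrivial (SimpleAt K r) := inferInstanceAs (Nontrivial K)
  refine ModuleTop.nonempty_equiv π (fun k => KDual.exists_eval_eq (K := K) hv k) fun φ hφ => ?_
  have hφ' : φ.eval v ≠ 0 := hφ
  rw [eq_top_iff]
  intro ψ _
  rw [Submodule.mem_span_singleton]
  -- The entries are forced: `φ` takes the value `a r w * φ(v)` at `a` times the basis vector of
  -- `w`, and this must equal the value of `ψ` there.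
  let a : IncidenceAlgebra K L := row K r fun w => ψ.eval (basisElt K w c • ξ) / φ.eval v
  refine ⟨MulOpposite.op a, KDual.ext fun n => ?_⟩
  obtain ⟨b, rfl⟩ := hgen n
  rw [KDual.smul_eval, MulOpposite.unop_op, ← mul_smul, hrow (a * b), KDual.eval_algebraMap_smul,
    hexp b, KDual.eval_sum, mul_apply_eq_sum, Finset.sum_mul]
  · refine Finset.sum_congr rfl fun w _ => ?_
    rw [KDual.eval_algebraMap_smul]
    simp only [a, row_apply, if_true]
    by_cases hw : r ≤ w
    · rw [Set.indicator_of_mem (Set.mem_Ici.2 hw)]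
      field_simp
    -- Basis vectors outside the interval are zero in `N`, so `ψ` vanishes on them as well.
    · rw [Set.indicator_of_notMem (by simpa using hw), (hker (basisElt K w c)).2]
      · have : ψ.eval 0 = 0 := LinearMap.map_zero (M := RestrictScalars K (IncidenceAlgebra K L) N) ψ
        rw [this]; ring
      · intro z hz hzc
        rw [basisElt, col_apply, if_pos rfl, Set.indicator_of_mem (Set.mem_Iic.2 hzc),
          Pi.single_eq_of_ne]
        rintro rfl
        exact hw hz
  · intro z hz
    rw [mul_apply_eq_sum]
    refine Finset.sum_eq_zero fun w _ => ?_
    rw [row_apply, if_neg hz.ne', zero_mul]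

end CyclicModule

/-! ### Finiteness -/

section Finite

variable {K : Type u} {L : Type u} [Field K] [PartialOrder L] [LocallyFiniteOrder L]
  [DecidableEq L] [Fintype L]

instance : Module.Finite K (IncidenceAlgebra K L) :=
  Module.Finite.of_injective (N := L → L → K)
    ({ toFun := fun a => a
       map_add' := fun _ _ => rfl
       map_smul' := fun _ _ => rfl } : IncidenceAlgebra K L →ₗ[K] L → L → K)
    DFunLike.coe_injective

instance : IsArtinianRing (IncidenceAlgebra K L)ᵐᵒᵖ :=
  haveI : Module.Finite K (IncidenceAlgebra K L)ᵐᵒᵖ :=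
    Module.Finite.equiv (MulOpposite.opLinearEquiv K)
  IsArtinianRing.of_finite K _

instance (x : L) : Module.Finite (IncidenceAlgebra K L)ᵐᵒᵖ (simpleModule K x) :=
  Module.Finite.of_surjective (LinearMap.toSpanSingleton (IncidenceAlgebra K L)ᵐᵒᵖ
    (SimpleAt K x) (1 : K)) fun (k : K) => by
    refine ⟨MulOpposite.op (algebraMap K (IncidenceAlgebra K L) k), ?_⟩
    change (1 : K) * (algebraMap K (IncidenceAlgebra K L) k) x x = k
    rw [Algebra.algebraMap_eq_smul_one, IncidenceAlgebra.constSMul_apply,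
      IncidenceAlgebra.one_apply, if_pos rfl, smul_eq_mul, mul_one, one_mul]

/-- The simple module at `x` as a module supported on `{x}`. -/
noncomputable def simpleModuleEquiv {C : Set L} [C.OrdConnected] {x : L} (hC : C = {x}) :
    IntervalModule K C ≃ₗ[(IncidenceAlgebra K L)ᵐᵒᵖ] SimpleAt K x where
  toFun f := f.1 x
  invFun (k : K) := IntervalModule.restrict C fun _ => (k : K)
  left_inv f := IntervalModule.ext fun z hz => by
    obtain rfl : z = x := by simpa [hC] using hz
    exact IntervalModule.restrict_val_of_mem hz
  right_inv k := IntervalModule.restrict_val_of_mem (K := K) (hC ▸ rfl)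
  map_add' _ _ := rfl
  map_smul' a f := by
    refine (IntervalModule.smul_val a f (hC ▸ rfl)).trans (Finset.sum_eq_single x ?_ (by simp))
    intro z _ hz
    rw [f.2 z (hC ▸ hz), zero_mul]

end Finite

/-! ### Joins of principal order ideals -/

section OrderIdeals

variable {L : Type u} [DistribLattice L] {P : Type v} [PartialOrder P] (e : L ≃o LowerSet P)

/-- The elements of `L` corresponding to the principal order ideals of a list of elements. -/
abbrev principals (l : List P) : List L := l.map fun m => e.symm (LowerSet.Iic m)

lemma mem_sup_principal {x : L} {m p : P} :
    p ∈ e (x ⊔ e.symm (LowerSet.Iic m)) ↔ p ∈ e x ∨ p ≤ m := by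
  rw [map_sup, OrderIso.apply_symm_apply, LowerSet.mem_sup_iff, LowerSet.mem_Iic_iff]

lemma principal_le_iff {x : L} {m : P} : e.symm (LowerSet.Iic m) ≤ x ↔ m ∈ e x := by
  rw [e.symm_apply_le, LowerSet.Iic_le]

lemma mem_listJoin_principals : ∀ (l : List P) {x : L} {p : P},
    p ∈ e (listJoin (principals e l) x) ↔ p ∈ e x ∨ ∃ m ∈ l, p ≤ m
  | [], x, p => by simp [listJoin]
  | m :: l, x, p => by
    refine (mem_listJoin_principals l).trans ?_
    rw [mem_sup_principal]
    simp [or_assoc]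

lemma le_iff_forall_mem {x y : L} : x ≤ y ↔ ∀ p ∈ e x, p ∈ e y := e.le_iff_le.symm

variable {e}

/-- Distinct minimal elements of the complement are incomparable, so adding one to the ideal leaves
the others minimal outside it. This is what lets the inductions change `x`. -/
lemma mem_sup_principal_of_lt {x : L} {l : List P} {m₀ : P} (hl : (m₀ :: l).Nodup)
    (hx : ∀ m ∈ m₀ :: l, m ∉ e x ∧ ∀ q < m, q ∈ e x) :
    ∀ m ∈ l, m ∉ e (x ⊔ e.symm (LowerSet.Iic m₀)) ∧
      ∀ q < m, q ∈ e (x ⊔ e.symm (LowerSet.Iic m₀)) := fun m hm => by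
  obtain ⟨hmx, hlt⟩ := hx m (List.mem_cons_of_mem m₀ hm)
  refine ⟨fun h => ?_, fun q hq => (mem_sup_principal e).2 (Or.inl (hlt q hq))⟩
  obtain h | h := (mem_sup_principal e).1 h
  · exact hmx h
  · obtain rfl | h := h.eq_or_lt
    · exact (List.nodup_cons.1 hl).1 hm
    · exact hmx ((hx m₀ List.mem_cons_self).2 m h)

/-- Everything strictly below `m₀` is already in `x`, so adjoining `m₀` to the join adds only the
point `m₀`. An ideal below the full join thus fails to lie below the join omitting `m₀` exactly when
it contains `m₀`. -/
lemma mem_essentialSet_principals : ∀ (l : List P) {x : L}, l.Nodup →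
    (∀ m ∈ l, m ∉ e x ∧ ∀ q < m, q ∈ e x) → ∀ {z : L},
    (z ∈ essentialSet (principals e l) x ↔
      z ≤ listJoin (principals e l) x ∧ ∀ m ∈ l, m ∈ e z)
  | [], x, _, _, z => by simp [essentialSet, listJoin]
  | m₀ :: l, x, hl, hx, z => by
    change z ∈ essentialSet (principals e l) (x ⊔ e.symm (LowerSet.Iic m₀)) ∧
      ¬ z ≤ listJoin (principals e l) x ↔
      z ≤ listJoin (principals e l) (x ⊔ e.symm (LowerSet.Iic m₀)) ∧ ∀ m ∈ m₀ :: l, m ∈ e z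
    rw [mem_essentialSet_principals l (List.nodup_cons.1 hl).2 (mem_sup_principal_of_lt hl hx),
      List.forall_mem_cons]
    obtain ⟨hm₀, hlt₀⟩ := hx m₀ List.mem_cons_self
    constructor
    · rintro ⟨⟨hz, hl'⟩, hnot⟩
      refine ⟨hz, by_contra fun hmz => hnot ((le_iff_forall_mem e).2 fun p hp => ?_), hl'⟩
      have h := (le_iff_forall_mem e).1 hz p hp
      rw [mem_listJoin_principals, mem_sup_principal] at h
      rw [mem_listJoin_principals]
      obtain (h | h) | h := h
      · exact Or.inl h
      · obtain rfl | h := h.eq_or_lt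
        · exact absurd hp hmz
        · exact Or.inl (hlt₀ p h)
      · exact Or.inr h
    · rintro ⟨hz, hmz, hl'⟩
      refine ⟨⟨hz, hl'⟩, fun h => ?_⟩
      have h := (le_iff_forall_mem e).1 h m₀ hmz
      rw [mem_listJoin_principals] at h
      obtain h | ⟨m, hm, h⟩ := h
      · exact hm₀ h
      · obtain rfl | h := h.eq_or_lt
        · exact (List.nodup_cons.1 hl).1 hm
        · exact hm₀ ((hx m (List.mem_cons_of_mem _ hm)).2 m₀ h)

/-- Containing every listed element is a condition independent of `x`; enlarging `x` only relaxes
the upper bound on the essential set. -/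
lemma isJoinIndependent_principals : ∀ (l : List P) {x : L}, l.Nodup →
    (∀ m ∈ l, m ∉ e x ∧ ∀ q < m, q ∈ e x) → IsJoinIndependent (principals e l) x
  | [], _, _, _ => trivial
  | m₀ :: l, x, hl, hx => by
    have hl' := (List.nodup_cons.1 hl).2
    have hx₁ : ∀ m ∈ l, m ∉ e x ∧ ∀ q < m, q ∈ e x := fun m hm => hx m (List.mem_cons_of_mem _ hm)
    have hx₂ := mem_sup_principal_of_lt hl hx
    refine ⟨isJoinIndependent_principals l hl' hx₁, isJoinIndependent_principals l hl' hx₂,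
      fun z hz => ?_⟩
    have hz' := (mem_essentialSet_principals l hl' hx₁).1 hz
    exact (mem_essentialSet_principals l hl' hx₂).2
      ⟨hz'.1.trans (listJoin_mono _ le_sup_left), hz'.2⟩

variable [Finite P]

lemma exists_minimal_of_not_le {x y : L} (h : ¬ y ≤ x) :
    ∃ m, Minimal (fun q => q ∉ e x) m ∧ m ∈ e y := by
  rw [le_iff_forall_mem e] at h
  push Not at h
  obtain ⟨p, hpy, hpx⟩ := h
  obtain ⟨m, hmp, hm⟩ := exists_minimal_le_of_wellFoundedLT (fun q => q ∉ e x) p hpx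
  exact ⟨m, hm, (e y).lower hmp hpy⟩

lemma Minimal.mem_of_lt {x : L} {m q : P} (hm : Minimal (fun q => q ∉ e x) m) (h : q < m) :
    q ∈ e x := by_contra fun hq => hm.not_prop_of_lt h hq

lemma Minimal.le_of_mem_sup_principal {x : L} {m m' : P} (hm : Minimal (fun q => q ∉ e x) m)
    (h : m ∈ e (x ⊔ e.symm (LowerSet.Iic m'))) : m ≤ m' :=
  ((mem_sup_principal e).1 h).resolve_left hm.prop

/-- A strictly larger ideal contains a minimal element of the complement, and adding such an element
adds a single point. -/
lemma covers_eq_image (x : L) :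
    covers x = (fun m => x ⊔ e.symm (LowerSet.Iic m)) '' {m | Minimal (fun q => q ∉ e x) m} := by
  have hlt : ∀ m, Minimal (fun q => q ∉ e x) m → x < x ⊔ e.symm (LowerSet.Iic m) := fun m hm =>
    lt_of_le_not_ge le_sup_left fun h =>
      hm.prop ((principal_le_iff e).1 (le_sup_right.trans h))
  ext y
  constructor
  · intro hy
    obtain ⟨m, hm, hmy⟩ := exists_minimal_of_not_le (e := e) hy.lt.not_ge
    refine ⟨m, hm, ?_⟩
    exact (hy.eq_or_eq le_sup_left (sup_le hy.le ((principal_le_iff e).2 hmy))).resolve_left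
      (hlt m hm).ne'
  · rintro ⟨m, hm, rfl⟩
    rw [Set.mem_ofPred_eq] at hm
    refine ⟨hlt m hm, fun w hxw hw => ?_⟩
    obtain ⟨m', hm', hmw⟩ := exists_minimal_of_not_le (e := e) hxw.not_ge
    have h := hm'.le_of_mem_sup_principal ((le_iff_forall_mem e).1 hw.le m' hmw)
    obtain rfl := hm.eq_of_le hm'.prop h
    exact hw.not_ge (sup_le hxw.le ((principal_le_iff e).2 hmw))

lemma ncard_covers (x : L) : (covers x).ncard = {m | Minimal (fun q => q ∉ e x) m}.ncard := by
  rw [covers_eq_image (e := e), Set.InjOn.ncard_image]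
  intro m hm m' hm' h
  have hmem : ∀ p, p ∈ e (x ⊔ e.symm (LowerSet.Iic p)) := fun p =>
    (mem_sup_principal e).2 (Or.inr le_rfl)
  dsimp only at h
  exact le_antisymm (Minimal.le_of_mem_sup_principal hm (h ▸ hmem m))
    (Minimal.le_of_mem_sup_principal hm' (h ▸ hmem m'))

/-- This identifies the final iterated quotient with `S_x`: every ideal strictly above `x` contains
one of the listed elements. -/
lemma joinRegion_principals {x : L} {l : List P}
    (hl : ∀ m, m ∈ l ↔ Minimal (fun q => q ∉ e x) m) : joinRegion (principals e l) x = {x} := by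
  ext y
  rw [Set.mem_singleton_iff]
  constructor
  · rintro ⟨hxy, hy⟩
    refine le_antisymm (by_contra fun h => ?_) hxy
    obtain ⟨m, hm, hmy⟩ := exists_minimal_of_not_le (e := e) h
    exact hy _ (List.mem_map_of_mem ((hl m).2 hm)) ((principal_le_iff e).2 hmy)
  · rintro rfl
    refine ⟨le_rfl, fun t ht h => ?_⟩
    obtain ⟨m, hm, rfl⟩ := List.mem_map.1 ht
    exact ((hl m).1 hm).prop ((principal_le_iff e).1 h)

lemma rowmotion_le_iff {x z : L} :
    e.symm (rowmotion (e x)) ≤ z ↔ ∀ m, Minimal (fun q => q ∉ e x) m → m ∈ e z := by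
  rw [e.symm_apply_le, rowmotion, lowerClosure_le]
  rfl

end OrderIdeals

/-! ### The main theorem -/

theorem theorem4 (K : Type u) [Field K] (L : Type u) [DistribLattice L] [Finite L]
    [LocallyFiniteOrder L] [DecidableEq L]
    (P : Type v) [PartialOrder P] [Finite P] (e : L ≃o LowerSet P) (x : L) :
    moduleGrade (simpleModule K x) = ((covers x).ncard : ℕ∞) ∧
    projectiveDimension (simpleModule K x) = (((covers x).ncard : ℕ∞) : WithBot ℕ∞) ∧
    Nonempty (GradeMap K (simpleModule K x) ≃ₗ[(IncidenceAlgebra K L)ᵐᵒᵖ]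
      simpleModule K (e.symm (rowmotion (e x)))) ∧
    ((covers x).Nonempty →
      (∃ N : ModuleCat.{u} (IncidenceAlgebra K L)ᵐᵒᵖ,
        IsARTranslate K (covers x).ncard (simpleModule K x) N) ∧
      ∀ N : ModuleCat.{u} (IncidenceAlgebra K L)ᵐᵒᵖ,
        IsARTranslate K (covers x).ncard (simpleModule K x) N →
        Nonempty (ModuleTop (IncidenceAlgebra K L)ᵐᵒᵖ N ≃ₗ[(IncidenceAlgebra K L)ᵐᵒᵖ]
          simpleModule K (e.symm (rowmotion (e x))))) := by
  cases nonempty_fintype L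
  -- Any ordering of the minimal elements serves; each is used once.
  let l : List P := (Set.toFinite {m | Minimal (fun q => q ∉ e x) m}).toFinset.toList
  have hl : ∀ m, m ∈ l ↔ Minimal (fun q => q ∉ e x) m := fun m => by simp [l]
  have hnodup : l.Nodup := Finset.nodup_toList _
  have hl' : ∀ m ∈ l, m ∉ e x ∧ ∀ q < m, q ∈ e x := fun m hm =>
    ⟨((hl m).1 hm).prop, fun _ hq => ((hl m).1 hm).mem_of_lt hq⟩
  let T : List L := principals e l
  have hcard : (covers x).ncard = T.length := by
    rw [ncard_covers (e := e), Set.ncard_eq_toFinset_card _ (Set.toFinite _), List.length_map,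
      Finset.length_toList]
  rw [hcard]
  let r : L := e.symm (rowmotion (e x))
  let c : L := listJoin T x
  -- Containing all the minimal elements means containing the ideal they generate, so the essential
  -- set is the interval from `row x` to the full join.
  have hess : ∀ z, z ∈ essentialSet T x ↔ r ≤ z ∧ z ≤ c := fun z => by
    rw [mem_essentialSet_principals l hnodup hl', rowmotion_le_iff, and_comm]
    simp only [hl, c, T]
  have hrc : r ≤ c := rowmotion_le_iff.2 fun m hm =>
    (mem_listJoin_principals e l).2 (Or.inr ⟨m, (hl m).2 hm, le_rfl⟩)
  have iso : koszulModule K T x ≅ simpleModule K x :=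
    (simpleModuleEquiv (joinRegion_principals hl)).toModuleIso
  have hpd : HasProjectiveDimensionLT (simpleModule K x) (T.length + 1) :=
    hasProjectiveDimensionLT_of_iso iso _
  have hvanish : ∀ n < T.length, Subsingleton (ExtReg (simpleModule K x) n) := fun n hn =>
    have := subsingleton_extReg_koszulModule (K := K) T x
      (isJoinIndependent_principals l hnodup hl') n hn
    (ExtReg.congr iso n).injective.subsingleton
  let ξ : ExtReg (simpleModule K x) T.length := (ExtReg.congr iso _).symm (koszulClass K T x)
  have hgen : ∀ η : ExtReg (simpleModule K x) T.length,
      ∃ a : IncidenceAlgebra K L, a • ξ = η := fun η => by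
    obtain ⟨a, ha⟩ := exists_smul_koszulClass T x (ExtReg.congr iso _ η)
    exact ⟨a, by rw [← map_smul, ha, LinearEquiv.symm_apply_apply]⟩
  have hker : ∀ a : IncidenceAlgebra K L, a • ξ = 0 ↔ ∀ z, r ≤ z → z ≤ c → a z c = 0 :=
    fun a => by
      rw [← map_smul, LinearEquiv.map_eq_zero_iff, smul_koszulClass_eq_zero_iff]
      simp only [hess, and_imp, c]
  have htop := nonempty_top_kDual_equiv hrc ξ hgen hker
  -- The identity has entry one at `(c, c)` and `c` lies in the interval, so it cannot annihilate
  -- `ξ`.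
  have hnontriv : Nontrivial (ExtReg (simpleModule K x) T.length) := by
    refine nontrivial_of_ne ξ 0 fun h => one_ne_zero (α := K) ?_
    rw [← one_smul (IncidenceAlgebra K L) ξ, hker] at h
    have := h c hrc le_rfl
    rwa [IncidenceAlgebra.one_apply, if_pos rfl] at this
  have hgrade : moduleGrade (simpleModule K x) = (T.length : ℕ∞) := by
    refine le_antisymm (iInf₂_le T.length hnontriv) (le_iInf₂ fun n hn => ?_)
    rw [Nat.cast_le]
    by_contra! h
    exact not_subsingleton_iff_nontrivial.2 hn (hvanish n h)
  refine ⟨hgrade, le_antisymm ?_ ?_, ?_, fun hne => ⟨?_, fun N hN => ?_⟩⟩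
  · exact (projectiveDimension_le_iff _ _).2 hpd
  · refine (projectiveDimension_ge_iff _ _).2 fun h => not_subsingleton_iff_nontrivial.2 hnontriv ?_
    exact ExtReg.subsingleton_of_hasProjectiveDimensionLT _ le_rfl
  · unfold GradeMap
    rw [hgrade]
    exact htop
  · refine exists_isARTranslate K _ ?_
    rw [← hcard]
    exact (Set.ncard_pos).2 hne
  · obtain ⟨f⟩ := hN.nonempty_equiv
    obtain ⟨g⟩ := htop
    exact ⟨(ModuleTop.congr f).trans g⟩
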